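/- **Setting.** Let $\mathbb K$ be an algebraically closed field of characteristic zero, $N\ge 1$, $M\geq 0$, and let $\omega\in\mathbb R^N$ have rationally independent coordinates. $\mathcal S_\omega$ is the ring of $\omega$-positive Puiseux series: the series $\varphi=\sum_{\alpha\in\mathbb Q^N}c_\alpha x^\alpha$ ($c_\alpha\in\mathbb K$) whose set of exponents $\{\alpha: c_\alpha\ne0\}$ lies in $\frac1k\mathbb Z^N$ for some integer $k\geq 1$ and has a translate by a vector of $\mathbb Q^N$ contained in a cone $\sigma$ generated by finitely many vectors of $\mathbb Q^N$ with $\omega\cdot v\ge 0$ for all $v\in\sigma$. Write $\mathbb K[x^*,y]=\mathbb K[x_1^{\pm1},\dots,x_N^{\pm1},y_1,\dots,y_M]$. An ideal $\mathcal I\subset\mathbb K[x^*,y]$ is *$N$-admissible* if the projection to $\mathbb K^N$ (the $x$-coordinates) of the zero set in $\mathbb K^{N+M}$ of $\mathcal I\cap\mathbb K[x,y]$ is dominant with finite generic fibre. An *$\omega$-solution* of $\mathcal I$ is $\phi\in\mathcal S_\omega^M$ with $f(x,\phi(x))=0$ for all $f\in\mathcal I$. **Initial ideals.** Put $\infty\cdot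 0=0$ and $\infty\cdot a=\infty$ for $a\in\mathbb R\setminus\{0\}$. Let $\eta\in(\mathbb R\cup\{\infty\})^M$ and $\Lambda(\eta)=\{i:\eta_i\neq\infty\}$. The order of $f=\sum a_{\alpha,\beta}x^\alpha y^\beta\in\mathbb K[x^*,y]$ is $\nu(f)=\min_{a_{\alpha,\beta}\ne0}(\omega\cdot\alpha+\eta\cdot\beta)$ (with $\nu(0)=\infty$); its initial part is the sum of the terms with $\omega\cdot\alpha+\eta\cdot\beta=\nu(f)$ if $\nu(f)<\infty$, and $0$ otherwise. $\mathrm{In}_{\omega,\eta}\mathcal I$ is the ideal generated by the initial parts of all $f\in\mathcal I$ and by the $y_i$ with $i\notin\Lambda(\eta)$. The pair $(\omega,\eta)$ is in the tropical variety of $\mathcal I$ if $\mathrm{In}_{\omega,\eta}\mathcal I\cap\mathbb K[x^*,y_{\Lambda(\eta)}]$ contains no monomial $cx^\alpha y^\beta$, $c\neq0$. **$\omega$-sequences.** An *$\omega$-set* is a triple $D=(\eta,\Gamma,c)$ with $\eta\in(\mathbb R\cup\{\infty\})^M$, $\Gamma\in\mathcal M_{M\times N}(\mathbb Q\cup\{\infty\})$,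 $c\in\mathbb K^M$, such that $\omega\cdot\Gamma^T=\eta$, the $i$-th row of $\Gamma$ is $(\infty,\dots,\infty)$ if $\eta_i=\infty$, and $c_i\ne0$ if and only if $\eta_i\neq\infty$. Let $\mathfrak M_D=(c_ix^{\Gamma_{i,*}})_{i}$ (an entry is $0$ when $c_i=0$), let $\mathfrak M_D(x^{rI})=(c_ix^{r\Gamma_{i,*}})_i$ for $r\in\mathbb Q$, and let $\mathbf d\Gamma\ge1$ be the least common multiple of the denominators of the finite entries of $\Gamma$. $D$ is a *starting $\omega$-set* for $\mathcal I$ if $(\omega,\eta)$ is in the tropical variety of $\mathcal I$ and $f(1,\dots,1,c)=0$ for all $f\in\mathrm{In}_{\omega,\eta}\mathcal I$. Let $$\mathcal I_D=\big\langle f(x_1^{\mathbf d\Gamma},\dots,x_N^{\mathbf d\Gamma},\,y+\mathfrak M_D(x^{\mathbf d\Gamma I})) : f\in\mathcal I\big\rangle\subset\mathbb K[x^*,y].$$ For $L\in\mathbb Z_{\ge0}\cup\{\infty\}$, a sequence $S=\{D^{(i)}\}_{0\le i\le L}$ (over all integers $i\ge0$ if $L=\infty$), $D^{(i)}=(\eta^{(i)},\Gamma^{(i)},c^{(i)})$,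 is an *$\omega$-sequence* for $\mathcal I$ if, with $\mathcal I^{(0)}=\mathcal I$ and $\mathcal I^{(i)}=(\mathcal I^{(i-1)})_{D^{(i-1)}}$, each $D^{(i)}$ is a starting $\omega$-set for $\mathcal I^{(i)}$, and for each $i\geq1$ and each $j\in\Lambda(\eta^{(i)})$ one has $\eta^{(i)}_j>\mathbf d\Gamma^{(i-1)}\,\eta^{(i-1)}_j$. The $M$-tuple of series *defined by* $S$ is the formal sum $$\mathbf{ser}(S)=\sum_{0\le i\le L}\mathfrak M_{D^{(i)}}(x^{r^{(i)}I}),\qquad r^{(i)}=\prod_{j=0}^{i-1}\frac1{\mathbf d\Gamma^{(j)}}.$$ **Statement.** Let $\mathcal I\subset\mathbb K[x^*,y]$ be an $N$-admissible ideal. 1. For every $\omega$-sequence $S$ for $\mathcal I$, finite or infinite, each exponent occurs in only finitely many terms of the sum $\mathbf{ser}(S)$ in each coordinate, and $\mathbf{ser}(S)\in\mathcal S_\omega^M$. 2. An $M$-tuple $\phi\in\mathcal S_\omega^M$ is an $\omega$-solution of $\mathcal I$ if and only if $\phi=\mathbf{ser}(S)$ for some infinite $\omega$-sequence $S=\{D^{(i)}\}_{i=0}^\infty$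 for $\mathcal I$. -/

import Mathlib

open MvPolynomial

noncomputable section

/-! ### Exponents ordered by a weight vector -/

/-- The weight `ω · α` of a rational exponent vector. -/
def omegaDot {N : ℕ} (ω : Fin N → ℝ) (α : Fin N → ℚ) : ℝ := ∑ l, ω l * (α l : ℝ)

/-- The additive group `ℚ ^ N` of exponents, ordered by means of `ω`. -/
def OmegaExp {N : ℕ} (_ω : Fin N → ℝ) : Type := Fin N → ℚ

/-- A rational vector, as an exponent. -/
def toExp {N : ℕ} (ω : Fin N → ℝ) (α : Fin N → ℚ) : OmegaExp ω := α

instance {N : ℕ} (ω : Fin N → ℝ) : AddCommGroup (OmegaExp ω) :=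
  inferInstanceAs (AddCommGroup (Fin N → ℚ))

lemma omegaDot_add {N : ℕ} (ω : Fin N → ℝ) (a b : OmegaExp ω) :
    omegaDot ω (a + b) = omegaDot ω a + omegaDot ω b := by
  simp only [omegaDot, ← Finset.sum_add_distrib]
  refine Finset.sum_congr rfl fun l _ => ?_
  have : (a + b) l = a l + b l := rfl
  rw [this]; push_cast; ring

/-- `α ≤ α'` if and only if `ω · α < ω · α'` or `α = α'`. When the coordinates of `ω` are rationally
independent, `α ↦ ω · α` is injective, and this is the total order
`α ≤ α' ↔ ω · α ≤ ω · α'`. -/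
instance {N : ℕ} (ω : Fin N → ℝ) : PartialOrder (OmegaExp ω) where
  le a b := a = b ∨ omegaDot ω a < omegaDot ω b
  le_refl a := Or.inl rfl
  le_trans a b c := by
    rintro (rfl | h) (rfl | h')
    · exact Or.inl rfl
    · exact Or.inr h'
    · exact Or.inr h
    · exact Or.inr (h.trans h')
  le_antisymm a b := by
    rintro (rfl | h) (h' | h')
    · rfl
    · rfl
    · exact h'.symm
    · exact absurd h' h.asymm

lemma OmegaExp.le_def {N : ℕ} {ω : Fin N → ℝ} {a b : OmegaExp ω} :
    a ≤ b ↔ a = b ∨ omegaDot ω a < omegaDot ω b := Iff.rfl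

instance {N : ℕ} (ω : Fin N → ℝ) : IsOrderedCancelAddMonoid (OmegaExp ω) where
  add_le_add_left a b h c := by
    rcases h with rfl | h
    · exact Or.inl rfl
    · refine Or.inr ?_
      rw [omegaDot_add, omegaDot_add]; linarith
  le_of_add_le_add_left a b c h := by
    rcases h with h | h
    · exact Or.inl (add_left_cancel h)
    · refine Or.inr ?_
      rw [omegaDot_add, omegaDot_add] at h; linarith

/-! ### The ring of `ω`-positive Puiseux series -/

/-- The real vector with the given rational coordinates. -/
def realVec {N : ℕ} (α : Fin N → ℚ) : Fin N → ℝ := fun l => (α l : ℝ)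

/-- Convex rational polyhedral cones: the cones generated by finitely many rational vectors. -/
def IsRationalCone {N : ℕ} (σ : PointedCone ℝ (Fin N → ℝ)) : Prop :=
  ∃ s : Finset (Fin N → ℚ), σ = PointedCone.hull ℝ (realVec '' (s : Set (Fin N → ℚ)))

/-- The cone `σ` is `ω`-positive. -/
def IsOmegaPositiveCone {N : ℕ} (ω : Fin N → ℝ) (σ : PointedCone ℝ (Fin N → ℝ)) : Prop :=
  ∀ v ∈ σ, 0 ≤ ∑ l, ω l * v l

/-- A set of exponents of an `ω`-positive Puiseux series: it lies in a lattice `(1/k) ℤ ^ N`, and a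
translate of it lies in an `ω`-positive rational cone. -/
def IsOmegaPuiseuxSupport {N : ℕ} (ω : Fin N → ℝ) (E : Set (Fin N → ℚ)) : Prop :=
  (∃ k : ℕ, 0 < k ∧ ∀ α ∈ E, ∀ l, ∃ z : ℤ, α l = (z : ℚ) / (k : ℚ)) ∧
  ∃ (γ : Fin N → ℚ) (σ : PointedCone ℝ (Fin N → ℝ)), IsRationalCone σ ∧
    IsOmegaPositiveCone ω σ ∧ ∀ α ∈ E, realVec (γ + α) ∈ σ

lemma realVec_add {N : ℕ} (a b : Fin N → ℚ) : realVec (a + b) = realVec a + realVec b := by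
  ext l; simp [realVec]

lemma IsOmegaPuiseuxSupport.mono {N : ℕ} {ω : Fin N → ℝ} {E F : Set (Fin N → ℚ)}
    (hF : IsOmegaPuiseuxSupport ω F) (h : E ⊆ F) : IsOmegaPuiseuxSupport ω E := by
  obtain ⟨⟨k, hk, h1⟩, γ, σ, hr, hp, h2⟩ := hF
  exact ⟨⟨k, hk, fun α hα => h1 α (h hα)⟩, γ, σ, hr, hp, fun α hα => h2 α (h hα)⟩

lemma isRationalCone_sup {N : ℕ} {σ τ : PointedCone ℝ (Fin N → ℝ)} (hσ : IsRationalCone σ)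
    (hτ : IsRationalCone τ) : IsRationalCone (σ ⊔ τ) := by
  classical
  obtain ⟨s, rfl⟩ := hσ
  obtain ⟨t, rfl⟩ := hτ
  refine ⟨s ∪ t, ?_⟩
  rw [Finset.coe_union, Set.image_union]
  exact (Submodule.span_union _ _).symm

lemma isOmegaPositiveCone_sup {N : ℕ} {ω : Fin N → ℝ} {σ τ : PointedCone ℝ (Fin N → ℝ)}
    (hσ : IsOmegaPositiveCone ω σ) (hτ : IsOmegaPositiveCone ω τ) :
    IsOmegaPositiveCone ω (σ ⊔ τ) := by
  intro v hv
  obtain ⟨a, ha, b, hb, rfl⟩ := Submodule.mem_sup.1 hv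
  have := hσ a ha
  have := hτ b hb
  simp only [Pi.add_apply, mul_add, Finset.sum_add_distrib]
  linarith

lemma isOmegaPositiveCone_hull_singleton {N : ℕ} {ω : Fin N → ℝ} {w : Fin N → ℝ}
    (hw : 0 ≤ ∑ l, ω l * w l) : IsOmegaPositiveCone ω (PointedCone.hull ℝ {w}) := by
  intro v hv
  obtain ⟨a, rfl⟩ := Submodule.mem_span_singleton.1 hv
  have : ∑ l, ω l * (a • w) l = (a : ℝ) * ∑ l, ω l * w l := by
    rw [Finset.mul_sum]
    refine Finset.sum_congr rfl fun l _ => ?_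
    change ω l * ((a : ℝ) * w l) = _
    ring
  rw [this]
  exact mul_nonneg a.2 hw

lemma isOmegaPuiseuxSupport_singleton {N : ℕ} (ω : Fin N → ℝ) (α : Fin N → ℚ) :
    IsOmegaPuiseuxSupport ω {α} := by
  refine ⟨⟨∏ l, (α l).den, Finset.prod_pos fun l _ => (α l).den_pos, ?_⟩, -α, ⊥, ?_, ?_, ?_⟩
  · intro β hβ l
    rw [Set.mem_singleton_iff.1 hβ]
    obtain ⟨m, hm⟩ := Finset.dvd_prod_of_mem (fun l => (α l).den) (Finset.mem_univ l)
    refine ⟨(α l).num * m, ?_⟩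
    have h0 : ∏ l, (α l).den ≠ 0 := Finset.prod_ne_zero_iff.2 fun l _ => (α l).den_nz
    have h2 : (m : ℚ) ≠ 0 := by
      intro h
      have h' : m = 0 := by exact_mod_cast h
      rw [hm, h', mul_zero] at h0
      exact h0 rfl
    rw [hm]
    push_cast
    rw [mul_div_mul_right _ _ h2]
    exact (Rat.num_div_den (α l)).symm
  · exact ⟨∅, by simp⟩
  · intro v hv
    rw [Submodule.mem_bot] at hv
    simp [hv]
  · intro β hβ
    rw [Set.mem_singleton_iff.1 hβ, Submodule.mem_bot]
    ext l; simp [realVec]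

lemma isOmegaPuiseuxSupport_union_aux {N : ℕ} {ω : Fin N → ℝ} {E F : Set (Fin N → ℚ)}
    {γ δ : Fin N → ℚ} {σ τ : PointedCone ℝ (Fin N → ℝ)} {k m : ℕ} (hk : 0 < k) (hm : 0 < m)
    (h1 : ∀ α ∈ E, ∀ l, ∃ z : ℤ, α l = (z : ℚ) / (k : ℚ))
    (h2 : ∀ α ∈ F, ∀ l, ∃ z : ℤ, α l = (z : ℚ) / (m : ℚ))
    (hσr : IsRationalCone σ) (hσp : IsOmegaPositiveCone ω σ) (hσ : ∀ α ∈ E, realVec (γ + α) ∈ σ)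
    (hτr : IsRationalCone τ) (hτp : IsOmegaPositiveCone ω τ) (hτ : ∀ α ∈ F, realVec (δ + α) ∈ τ)
    (hle : 0 ≤ ∑ l, ω l * realVec (γ - δ) l) : IsOmegaPuiseuxSupport ω (E ∪ F) := by
  have hk' : (k : ℚ) ≠ 0 := by exact_mod_cast hk.ne'
  have hm' : (m : ℚ) ≠ 0 := by exact_mod_cast hm.ne'
  refine ⟨⟨k * m, Nat.mul_pos hk hm, ?_⟩, γ,
    (σ ⊔ τ) ⊔ PointedCone.hull ℝ {realVec (γ - δ)}, ?_, ?_, ?_⟩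
  · rintro α (hα | hα) l
    · obtain ⟨z, hz⟩ := h1 α hα l
      refine ⟨z * m, ?_⟩
      rw [hz]; push_cast; field_simp
    · obtain ⟨z, hz⟩ := h2 α hα l
      refine ⟨z * k, ?_⟩
      rw [hz]; push_cast; field_simp
  · exact isRationalCone_sup (isRationalCone_sup hσr hτr) ⟨{γ - δ}, by simp⟩
  · exact isOmegaPositiveCone_sup (isOmegaPositiveCone_sup hσp hτp)
      (isOmegaPositiveCone_hull_singleton hle)
  · rintro α (hα | hα)
    · exact Submodule.mem_sup_left (Submodule.mem_sup_left (hσ α hα))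
    · have : γ + α = (δ + α) + (γ - δ) := by abel
      rw [this, realVec_add]
      exact add_mem (Submodule.mem_sup_left (Submodule.mem_sup_right (hτ α hα)))
        (Submodule.mem_sup_right (Submodule.subset_span rfl))

lemma IsOmegaPuiseuxSupport.union {N : ℕ} {ω : Fin N → ℝ} {E F : Set (Fin N → ℚ)}
    (hE : IsOmegaPuiseuxSupport ω E) (hF : IsOmegaPuiseuxSupport ω F) :
    IsOmegaPuiseuxSupport ω (E ∪ F) := by
  obtain ⟨⟨k, hk, h1⟩, γ, σ, hσr, hσp, hσ⟩ := hE
  obtain ⟨⟨m, hm, h2⟩, δ, τ, hτr, hτp, hτ⟩ := hF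
  rcases le_total 0 (∑ l, ω l * realVec (γ - δ) l) with h | h
  · exact isOmegaPuiseuxSupport_union_aux hk hm h1 h2 hσr hσp hσ hτr hτp hτ h
  · rw [Set.union_comm]
    refine isOmegaPuiseuxSupport_union_aux hm hk h2 h1 hτr hτp hτ hσr hσp hσ ?_
    have : ∑ l, ω l * realVec (δ - γ) l = - ∑ l, ω l * realVec (γ - δ) l := by
      rw [← Finset.sum_neg_distrib]
      refine Finset.sum_congr rfl fun l _ => ?_
      simp only [realVec, Pi.sub_apply]; push_cast; ring
    rw [this]; linarith

lemma IsOmegaPuiseuxSupport.add {N : ℕ} {ω : Fin N → ℝ} {E F G : Set (Fin N → ℚ)}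
    (hE : IsOmegaPuiseuxSupport ω E) (hF : IsOmegaPuiseuxSupport ω F)
    (hG : ∀ g ∈ G, ∃ a ∈ E, ∃ b ∈ F, a + b = g) : IsOmegaPuiseuxSupport ω G := by
  obtain ⟨⟨k, hk, h1⟩, γ, σ, hσr, hσp, hσ⟩ := hE
  obtain ⟨⟨m, hm, h2⟩, δ, τ, hτr, hτp, hτ⟩ := hF
  have hk' : (k : ℚ) ≠ 0 := by exact_mod_cast hk.ne'
  have hm' : (m : ℚ) ≠ 0 := by exact_mod_cast hm.ne'
  refine ⟨⟨k * m, Nat.mul_pos hk hm, ?_⟩, γ + δ, σ ⊔ τ, isRationalCone_sup hσr hτr,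
    isOmegaPositiveCone_sup hσp hτp, ?_⟩
  · intro g hg l
    obtain ⟨a, ha, b, hb, rfl⟩ := hG g hg
    obtain ⟨z, hz⟩ := h1 a ha l
    obtain ⟨y, hy⟩ := h2 b hb l
    refine ⟨z * m + y * k, ?_⟩
    rw [Pi.add_apply, hz, hy]; push_cast; field_simp
  · intro g hg
    obtain ⟨a, ha, b, hb, rfl⟩ := hG g hg
    have : γ + δ + (a + b) = (γ + a) + (δ + b) := by abel
    rw [this, realVec_add]
    exact add_mem (Submodule.mem_sup_left (hσ a ha)) (Submodule.mem_sup_right (hτ b hb))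

/-- When the coordinates of `ω` are rationally independent, every set of exponents of an `ω`-positive
Puiseux series is well-ordered. -/
theorem IsOmegaPuiseuxSupport.isPWO {N : ℕ} {ω : Fin N → ℝ} (hω : LinearIndependent ℚ ω)
    {E : Set (OmegaExp ω)} (hE : IsOmegaPuiseuxSupport ω E) : E.IsPWO := by
  classical
  have hinj : ∀ a : Fin N → ℚ, omegaDot ω a = 0 → a = 0 := by
    intro a ha
    funext l
    refine Fintype.linearIndependent_iff.1 hω a ?_ l
    rw [← ha]
    exact Finset.sum_congr rfl fun i _ => by rw [Rat.smul_def, mul_comm]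
  obtain ⟨⟨k, hk, h1⟩, γ, σ, ⟨s, rfl⟩, hp, h2⟩ := hE
  have hkr : (0 : ℝ) < k := by exact_mod_cast hk
  obtain ⟨C, hC⟩ : ∃ C : ℝ, ∀ v ∈ PointedCone.hull ℝ (realVec '' (s : Set (Fin N → ℚ))), ∀ l,
      |v l| ≤ C * ∑ i, ω i * v i := by
    have hpos : ∀ w ∈ s, 0 ≤ omegaDot ω w := fun w hw =>
      hp _ (Submodule.subset_span ⟨w, hw, rfl⟩)
    refine ⟨∑ w ∈ s, ∑ l, |(w l : ℝ)| / omegaDot ω w, fun v hv l => ?_⟩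
    induction hv using Submodule.span_induction with
    | mem v hv =>
      obtain ⟨w, hw, rfl⟩ := hv
      change |(w l : ℝ)| ≤ _ * omegaDot ω w
      rcases (hpos w hw).eq_or_lt with h | h
      · have := hinj w h.symm
        subst this
        simp [omegaDot]
      · have hle : |(w l : ℝ)| / omegaDot ω w ≤ ∑ w ∈ s, ∑ l, |(w l : ℝ)| / omegaDot ω w := by
          refine le_trans ?_ (Finset.single_le_sum (f := fun w => ∑ l, |(w l : ℝ)| / omegaDot ω w)
            (fun u hu => Finset.sum_nonneg fun i _ => div_nonneg (abs_nonneg _) (hpos u hu)) hw)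
          exact Finset.single_le_sum (f := fun l => |(w l : ℝ)| / omegaDot ω w)
            (fun i _ => div_nonneg (abs_nonneg _) (hpos w hw)) (Finset.mem_univ l)
        exact (div_le_iff₀ h).1 hle
    | zero => simp
    | add u v _ _ hu hv =>
      simp only [Pi.add_apply, mul_add, Finset.sum_add_distrib]
      exact (abs_add_le _ _).trans (by simpa [mul_add] using add_le_add hu hv)
    | smul a v _ hv =>
      have e : ∑ i, ω i * (a • v) i = (a : ℝ) * ∑ i, ω i * v i := by
        rw [Finset.mul_sum]
        refine Finset.sum_congr rfl fun i _ => ?_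
        change ω i * ((a : ℝ) * v i) = _
        ring
      have e' : (a • v) l = (a : ℝ) * v l := rfl
      have ha : (0 : ℝ) ≤ a := a.2
      rw [e, e', abs_mul, abs_of_nonneg ha]
      nlinarith [mul_le_mul_of_nonneg_left hv ha]
  have hC0 : ∀ t : ℝ, {a ∈ E | omegaDot ω a ≤ t}.Finite := by
    intro t
    obtain ⟨B, hB⟩ : ∃ B : ℕ, ∀ a ∈ E, omegaDot ω a ≤ t → ∀ l, |(a l : ℝ)| * k ≤ B := by
      obtain ⟨B, hB⟩ := exists_nat_ge
        ((|C| * (omegaDot ω γ + t) + ∑ i, |(γ i : ℝ)|) * k)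
      refine ⟨B, fun a ha hat l => le_trans (mul_le_mul_of_nonneg_right ?_ hkr.le) hB⟩
      have h2' := h2 a ha
      change realVec (toExp ω γ + a) ∈ _ at h2'
      have h := hC _ h2' l
      have h0 := hp _ h2'
      have e : ∑ i, ω i * realVec (toExp ω γ + a) i = omegaDot ω γ + omegaDot ω a :=
        omegaDot_add ω γ a
      rw [e] at h h0
      have e2 : realVec (toExp ω γ + a) l = (γ l : ℝ) + (a l : ℝ) := by
        change (((γ l + a l : ℚ)) : ℝ) = _
        push_cast; rfl
      rw [e2] at h
      have h3 : |(γ l : ℝ)| ≤ ∑ i, |(γ i : ℝ)| :=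
        Finset.single_le_sum (f := fun i => |(γ i : ℝ)|) (fun i _ => abs_nonneg _)
          (Finset.mem_univ l)
      have h4 : |(a l : ℝ)| ≤ |(γ l : ℝ) + (a l : ℝ)| + |(γ l : ℝ)| := by
        have := abs_sub ((γ l : ℝ) + (a l : ℝ)) (γ l : ℝ)
        simpa using this
      have h5 : C * (omegaDot ω γ + omegaDot ω a) ≤ |C| * (omegaDot ω γ + t) :=
        (mul_le_mul_of_nonneg_right (le_abs_self C) h0).trans
          (mul_le_mul_of_nonneg_left (by linarith) (abs_nonneg C))
      linarith
    refine ((Set.Finite.pi' (fun _ : Fin N => Set.finite_Icc (-(B : ℤ)) B)).image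
      (fun z l => (z l : ℚ) / (k : ℚ))).subset ?_
    rintro a ⟨ha, hat⟩
    choose z hz using h1 a ha
    refine ⟨z, fun l => ?_, funext fun l => (hz l).symm⟩
    have h := hB a ha hat l
    rw [hz l] at h
    push_cast at h
    rw [abs_div, abs_of_pos hkr, div_mul_cancel₀ _ hkr.ne'] at h
    have h' : |z l| ≤ (B : ℤ) := by exact_mod_cast h
    exact abs_le.1 h'
  intro g
  set f : ℕ → OmegaExp ω := fun n => (g n).1 with hfdef
  have hf : ∀ n, f n ∈ E := fun n => (g n).2
  by_contra hcon
  push Not at hcon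
  have hlt : ∀ m n : ℕ, m < n → f m ≠ f n ∧ omegaDot ω (f n) ≤ omegaDot ω (f m) := by
    intro m n hmn
    have h : ¬ f m ≤ f n := hcon m n hmn
    exact ⟨fun h' => h (Or.inl h'), not_lt.1 fun h' => h (Or.inr h')⟩
  have hfinj : Function.Injective f := by
    intro m n hmn
    rcases lt_trichotomy m n with h | h | h
    · exact absurd hmn (hlt m n h).1
    · exact h
    · exact absurd hmn.symm (hlt n m h).1
  refine Set.infinite_of_injective_forall_mem hfinj (fun n => ?_) (hC0 (omegaDot ω (f 0)))
  refine ⟨hf n, ?_⟩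
  rcases Nat.eq_zero_or_pos n with rfl | h
  · exact le_rfl
  · exact (hlt 0 n h).2

/-- The ring `S_ω` of `ω`-positive Puiseux series with coefficients in `K`: the fractional power
series `∑ c_α x ^ α` whose set of exponents lies in a lattice and has a translate inside an
`ω`-positive rational cone. It is realised inside the Hahn series with exponents ordered by `ω`;
by `IsOmegaPuiseuxSupport.isPWO` this ambient ring imposes no further restriction. -/
def OmegaPuiseux {N : ℕ} (K : Type*) [Field K] (ω : Fin N → ℝ) :
    Subalgebra K (HahnSeries (OmegaExp ω) K) where
  carrier := {f | IsOmegaPuiseuxSupport ω {α | f.coeff (toExp ω α) ≠ 0}}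
  mul_mem' {f g} hf hg := by
    refine IsOmegaPuiseuxSupport.add hf hg fun α hα => ?_
    obtain ⟨a, ha, b, hb, hab⟩ := HahnSeries.support_mul_subset
      ((HahnSeries.mem_support (f * g) (toExp ω α)).2 hα)
    exact ⟨a, ha, b, hb, hab⟩
  add_mem' {f g} hf hg :=
    (IsOmegaPuiseuxSupport.union hf hg).mono fun α hα =>
      HahnSeries.support_add_subset f g ((HahnSeries.mem_support (f + g) (toExp ω α)).2 hα)
  algebraMap_mem' r := by
    refine (isOmegaPuiseuxSupport_singleton ω 0).mono fun α hα => ?_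
    exact HahnSeries.support_single_subset (a := (0 : OmegaExp ω)) (r := r)
      ((HahnSeries.mem_support _ (toExp ω α)).2 hα)

/-- The monomial `c x ^ α`, as an `ω`-positive Puiseux series. -/
def puiseuxMonomial {N : ℕ} {K : Type*} [Field K] (ω : Fin N → ℝ) (α : Fin N → ℚ) (c : K) :
    OmegaPuiseux K ω :=
  ⟨HahnSeries.single (toExp ω α) c, (isOmegaPuiseuxSupport_singleton ω α).mono fun β hβ =>
    HahnSeries.support_single_subset (a := toExp ω α) (r := c)
      ((HahnSeries.mem_support _ (toExp ω β)).2 hβ)⟩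

lemma puiseuxMonomial_mul {N : ℕ} {K : Type*} [Field K] (ω : Fin N → ℝ) (α β : Fin N → ℚ)
    (a b : K) : puiseuxMonomial ω α a * puiseuxMonomial ω β b = puiseuxMonomial ω (α + β) (a * b) :=
  Subtype.ext HahnSeries.single_mul_single

/-! ### The polynomial rings and `N`-admissible ideals -/

/-- The ring `K[x^*] = K[x₁, x₁⁻¹, …, x_N, x_N⁻¹]` of Laurent polynomials. -/
abbrev LaurentRing (N : ℕ) (K : Type*) [Field K] : Type _ := AddMonoidAlgebra K (Fin N → ℤ)

/-- The ring `K[x^*, y] = K[x^*][y₁, …, y_M]`. -/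
abbrev MixedRing (N M : ℕ) (K : Type*) [Field K] : Type _ := MvPolynomial (Fin M) (LaurentRing N K)

/-- The monomial `c x ^ α y ^ β` of `K[x^*, y]`. -/
def mixedMonomial {N M : ℕ} {K : Type*} [Field K] (α : Fin N → ℤ) (β : Fin M →₀ ℕ) (c : K) :
    MixedRing N M K :=
  MvPolynomial.monomial β (AddMonoidAlgebra.single α c)

/-- The inclusion of `K[x, y]` in `K[x^*, y]`. -/
def polyInclusion (N M : ℕ) (K : Type*) [Field K] :
    MvPolynomial (Fin N ⊕ Fin M) K →ₐ[K] MixedRing N M K :=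
  MvPolynomial.aeval
    (Sum.elim (fun l => mixedMonomial (Pi.single l 1) 0 1) (fun j => MvPolynomial.X j))

/-- An ideal `J` of `K[x, y]` is `N`-admissible when the projection of its zero set `V(J)` to the
`x`-coordinates is dominant (no nonzero polynomial vanishes on the image) and has finite generic
fibre (all the fibres over some nonempty principal open set are finite). -/
def IsAdmissible {N M : ℕ} {K : Type*} [Field K]
    (J : Ideal (MvPolynomial (Fin N ⊕ Fin M) K)) : Prop :=
  (∀ g : MvPolynomial (Fin N) K,
    (∀ p ∈ zeroLocus K J, MvPolynomial.eval (p ∘ Sum.inl) g = 0) → g = 0) ∧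
  ∃ g : MvPolynomial (Fin N) K, g ≠ 0 ∧ ∀ a : Fin N → K, MvPolynomial.eval a g ≠ 0 →
    {p ∈ zeroLocus K J | p ∘ Sum.inl = a}.Finite

/-- An ideal `I` of `K[x^*, y]` is `N`-admissible when `I ∩ K[x, y]` is. -/
def IsLaurentAdmissible {N M : ℕ} {K : Type*} [Field K] (I : Ideal (MixedRing N M K)) : Prop :=
  IsAdmissible (I.comap (polyInclusion N M K))

/-- The inclusion of `K[x^*]` in `S_ω`. -/
def laurentToPuiseux {N : ℕ} (K : Type*) [Field K] (ω : Fin N → ℝ) :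
    LaurentRing N K →ₐ[K] OmegaPuiseux K ω :=
  AddMonoidAlgebra.lift K (OmegaPuiseux K ω) (Fin N → ℤ)
    { toFun := fun α => puiseuxMonomial ω (fun l => (α.toAdd l : ℚ)) 1
      map_one' := by
        have h : (fun l => ((Multiplicative.toAdd (1 : Multiplicative (Fin N → ℤ)) l : ℤ) : ℚ))
            = (0 : Fin N → ℚ) := by
          funext l; simp
        rw [h]; rfl
      map_mul' := fun α β => by
        rw [puiseuxMonomial_mul, one_mul]
        congr 1
        funext l
        simp }

/-- `φ ∈ S_ω ^ M` is an `ω`-solution of `I` when `f(x, φ(x)) = 0` for all `f ∈ I`. -/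
def IsOmegaSolution {N M : ℕ} {K : Type*} [Field K] (ω : Fin N → ℝ) (I : Ideal (MixedRing N M K))
    (φ : Fin M → OmegaPuiseux K ω) : Prop :=
  ∀ f ∈ I, MvPolynomial.eval₂ (laurentToPuiseux K ω : LaurentRing N K →+* OmegaPuiseux K ω) φ f = 0

/-! ### Initial ideals and the tropical variety

In `WithTop ℝ` multiplication satisfies `⊤ * a = ⊤` for every `a ≠ 0` and `⊤ * 0 = 0`. -/

/-- The weight `ω · α + η · β` of the monomial `x ^ α y ^ β`. -/
def mixedWeight {N M : ℕ} (ω : Fin N → ℝ) (η : Fin M → WithTop ℝ) (α : Fin N → ℤ)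
    (β : Fin M →₀ ℕ) : WithTop ℝ :=
  ((∑ l, ω l * (α l : ℝ) : ℝ) : WithTop ℝ) + ∑ j, η j * (((β j : ℕ) : ℝ) : WithTop ℝ)

/-- The `(ω, η)`-order of a polynomial: the least weight of its monomials (`⊤` for `f = 0`). -/
def mixedOrder {N M : ℕ} {K : Type*} [Field K] (ω : Fin N → ℝ) (η : Fin M → WithTop ℝ)
    (f : MixedRing N M K) : WithTop ℝ :=
  f.support.inf fun β => (MvPolynomial.coeff β f).coeff.support.inf fun α => mixedWeight ω η α β

open Classical in
/-- The `(ω, η)`-initial part of a polynomial: the sum of its terms of least weight, and `0` if the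
order is `⊤`. -/
def initialPart {N M : ℕ} {K : Type*} [Field K] (ω : Fin N → ℝ) (η : Fin M → WithTop ℝ)
    (f : MixedRing N M K) : MixedRing N M K :=
  if mixedOrder ω η f = ⊤ then 0 else
    ∑ β ∈ f.support, ∑ α ∈ (MvPolynomial.coeff β f).coeff.support,
      if mixedWeight ω η α β = mixedOrder ω η f then
        mixedMonomial α β ((MvPolynomial.coeff β f).coeff α)
      else 0

/-- The `(ω, η)`-initial ideal, generated by the initial parts of the elements of `I` and by the
variables `y_j` with `η_j = ∞`. -/
def initialIdeal {N M : ℕ} {K : Type*} [Field K] (ω : Fin N → ℝ) (η : Fin M → WithTop ℝ)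
    (I : Ideal (MixedRing N M K)) : Ideal (MixedRing N M K) :=
  Ideal.span ({g | ∃ f ∈ I, g = initialPart ω η f} ∪ {g | ∃ j, η j = ⊤ ∧ g = MvPolynomial.X j})

/-- The tropical variety of `I`: the set of all `(ω, η)` such that the initial ideal contains no
monomial `c x ^ α y ^ β`, `c ≠ 0`, in the variables `x` and the `y_j` with `η_j ≠ ∞`. -/
def tropicalVariety {N M : ℕ} {K : Type*} [Field K] (I : Ideal (MixedRing N M K)) :
    Set ((Fin N → ℝ) × (Fin M → WithTop ℝ)) :=
  {p | ∀ (α : Fin N → ℤ) (β : Fin M →₀ ℕ) (c : K), c ≠ 0 → (∀ j, p.2 j = ⊤ → β j = 0) →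
    mixedMonomial α β c ∉ initialIdeal p.1 p.2 I}

/-! ### `ω`-sets -/

/-- Triples `(η, Γ, c)`. -/
structure OmegaData (N M : ℕ) (K : Type*) where
  /-- the orders -/
  η : Fin M → WithTop ℝ
  /-- the matrix of exponents -/
  Γ : Matrix (Fin M) (Fin N) (WithTop ℚ)
  /-- the coefficients -/
  c : Fin M → K

/-- The triple is an `ω`-set: `ω · Γᵀ = η`, the rows of `Γ` with `η_i = ∞` are `(∞, …, ∞)`, and
`c_i` is nonzero exactly when `η_i ≠ ∞`. -/
def IsOmegaSet {N M : ℕ} {K : Type*} [Field K] (ω : Fin N → ℝ) (D : OmegaData N M K) : Prop :=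
  (∀ i, ∑ l, (ω l : WithTop ℝ) * (D.Γ i l).map (fun q : ℚ => (q : ℝ)) = D.η i) ∧
  (∀ i, D.η i = ⊤ → ∀ l, D.Γ i l = ⊤) ∧
  (∀ i, D.c i ≠ 0 ↔ D.η i ≠ ⊤)

/-- The `M`-tuple of monomials `𝔐_D(x ^ {r I}) = (c_i x ^ {r Γ_i})_i`. The entries `∞` of `Γ`
occur, for an `ω`-set, only where `c_i = 0`, and the monomial is then `0`. -/
def OmegaData.monomials {N M : ℕ} {K : Type*} [Field K] (ω : Fin N → ℝ) (D : OmegaData N M K)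
    (r : ℚ) (i : Fin M) : OmegaPuiseux K ω :=
  puiseuxMonomial ω (fun l => r * (D.Γ i l).untopD 0) (D.c i)

/-- The least common multiple of the denominators of the finite entries of `Γ`. -/
def OmegaData.d {N M : ℕ} {K : Type*} (D : OmegaData N M K) : ℕ :=
  Finset.univ.lcm fun p : Fin M × Fin N => ((D.Γ p.1 p.2).untopD 0).den

/-- The ring homomorphism `K[x^*] → K`, `x ↦ (1, …, 1)`. -/
def evalOne (N : ℕ) (K : Type*) [Field K] : LaurentRing N K →ₐ[K] K :=
  AddMonoidAlgebra.lift K K (Fin N → ℤ) 1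

/-- `D` is a starting `ω`-set for `I`. -/
def IsStartingOmegaSet {N M : ℕ} {K : Type*} [Field K] (ω : Fin N → ℝ)
    (I : Ideal (MixedRing N M K)) (D : OmegaData N M K) : Prop :=
  IsOmegaSet ω D ∧ (ω, D.η) ∈ tropicalVariety I ∧
  ∀ f ∈ initialIdeal ω D.η I, MvPolynomial.eval₂ (evalOne N K : LaurentRing N K →+* K) D.c f = 0

/-! ### The ideals `I_D`, `ω`-sequences and the series they define -/

/-- The ring homomorphism `K[x^*] → K[x^*]`, `x ↦ x ^ {d I} = (x₁ ^ d, …, x_N ^ d)`. -/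
def ramify (N : ℕ) (K : Type*) [Field K] (d : ℕ) : LaurentRing N K →+* LaurentRing N K :=
  AddMonoidAlgebra.mapDomainRingHom K (d • AddMonoidHom.id (Fin N → ℤ))

/-- The substitution `f ↦ f(x ^ {d I}, y + 𝔐_D(x ^ {d I}))` of `K[x^*, y]`, with `d` the common
denominator of `Γ`. The exponents `d Γ_{i,l}` are integers, so they equal their numerators. -/
def OmegaData.subst {N M : ℕ} {K : Type*} [Field K] (D : OmegaData N M K) :
    MixedRing N M K →+* MixedRing N M K :=
  MvPolynomial.eval₂Hom (MvPolynomial.C.comp (ramify N K D.d)) fun i =>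
    MvPolynomial.X i + mixedMonomial (fun l => ((D.d : ℚ) * (D.Γ i l).untopD 0).num) 0 (D.c i)

/-- The ideal `I_D` generated by the `f(x ^ {d I}, y + 𝔐_D(x ^ {d I}))`, `f ∈ I`. -/
def idealStep {N M : ℕ} {K : Type*} [Field K] (I : Ideal (MixedRing N M K))
    (D : OmegaData N M K) : Ideal (MixedRing N M K) :=
  Ideal.span {g | ∃ f ∈ I, g = D.subst f}

/-- The ideals `I⁽⁰⁾ = I`, `I⁽ⁱ⁺¹⁾ = (I⁽ⁱ⁾)_{D⁽ⁱ⁾}`. -/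
def idealSeq {N M : ℕ} {K : Type*} [Field K] (I : Ideal (MixedRing N M K))
    (S : ℕ → OmegaData N M K) : ℕ → Ideal (MixedRing N M K)
  | 0 => I
  | i + 1 => idealStep (idealSeq I S i) (S i)

/-- `{D⁽ⁱ⁾}` for `0 ≤ i ≤ L`, where `L` is a natural number or `∞`, is an `ω`-sequence for `I`.
Only the terms `S i` with `i ≤ L` matter. -/
def IsOmegaSequence {N M : ℕ} {K : Type*} [Field K] (ω : Fin N → ℝ)
    (I : Ideal (MixedRing N M K)) (L : ℕ∞) (S : ℕ → OmegaData N M K) : Prop :=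
  (∀ i : ℕ, (i : ℕ∞) ≤ L → IsStartingOmegaSet ω (idealSeq I S i) (S i)) ∧
  ∀ i : ℕ, ((i + 1 : ℕ) : ℕ∞) ≤ L → ∀ j, (S (i + 1)).η j ≠ ⊤ →
    (((S i).d : ℝ) : WithTop ℝ) * (S i).η j < (S (i + 1)).η j

/-- `r⁽ⁱ⁾ = 1 / ∏_{j < i} d Γ⁽ʲ⁾`. -/
def ramIndex {N M : ℕ} {K : Type*} (S : ℕ → OmegaData N M K) (i : ℕ) : ℚ :=
  1 / ∏ j ∈ Finset.range i, ((S j).d : ℚ)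

/-- The set of the indices `i ≤ L` whose monomial `𝔐_{D⁽ⁱ⁾}(x ^ {r⁽ⁱ⁾ I})` contributes to the
coefficient of `x ^ γ` in the `j`-th coordinate of the series defined by the sequence. -/
def contributors {N M : ℕ} {K : Type*} [Field K] (ω : Fin N → ℝ) (L : ℕ∞)
    (S : ℕ → OmegaData N M K) (j : Fin M) (γ : OmegaExp ω) : Set ℕ :=
  {i | (i : ℕ∞) ≤ L ∧ ((S i).monomials ω (ramIndex S i) j).1.coeff γ ≠ 0}

/-- The coefficient of `x ^ γ` in the `j`-th coordinate of the formal sum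
`∑_{0 ≤ i ≤ L} 𝔐_{D⁽ⁱ⁾}(x ^ {r⁽ⁱ⁾ I})` (meaningful when finitely many terms contribute). -/
def serCoeff {N M : ℕ} {K : Type*} [Field K] (ω : Fin N → ℝ) (L : ℕ∞)
    (S : ℕ → OmegaData N M K) (j : Fin M) (γ : OmegaExp ω) : K :=
  ∑ᶠ i ∈ contributors ω L S j γ, ((S i).monomials ω (ramIndex S i) j).1.coeff γ

/-- `φ` is the `M`-tuple of series defined by the sequence: the formal sum
`∑_{0 ≤ i ≤ L} 𝔐_{D⁽ⁱ⁾}(x ^ {r⁽ⁱ⁾ I})` makes sense coefficientwise, and it is equal to `φ`. -/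
def IsSeriesOf {N M : ℕ} {K : Type*} [Field K] (ω : Fin N → ℝ) (L : ℕ∞)
    (S : ℕ → OmegaData N M K) (φ : Fin M → OmegaPuiseux K ω) : Prop :=
  ∀ j γ, (contributors ω L S j γ).Finite ∧ (φ j).1.coeff γ = serCoeff ω L S j γ

end

/-!
Substituting `y = ser(S) + z` puts `f ∈ I` into the form of a series in `z`, and the lowest part
of this series that involves one variable has a multiplicity, which cannot increase along the
sequence. It is therefore eventually constant, and in characteristic zero a Hasse derivative of `f`
then has a simple root along the sequence; from there on the exponents are obtained by a linear
equation and stay in a translate of a finitely generated monoid of exponents of nonnegative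
weight. This is why `ser(S)` is an `ω`-positive Puiseux series. An `N`-admissible ideal supplies,
by elimination, an equation in each single variable to which this applies.

An `ω`-set `D` is a starting `ω`-set for `I` if and only if the substitution of `𝔐_D` into any
`f ∈ I` gives a series of weight larger than the order of `f`. Hence the partial sums of an infinite
sequence satisfy the equations up to terms whose weight tends to infinity, and, conversely,
the leading terms of a solution, removed one after the other, form an `ω`-sequence.
-/

noncomputable section

/-! ### Elimination: generically finite fibres -/

section Elimination

lemma exists_ne_zero_forall_mem_range_comap {B S : Type*} [CommRing B] [IsDomain B]
    [CommRing S] (f : B →+* S) (hf : f.FinitePresentation) (hinj : Function.Injective f) :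
    ∃ h : B, h ≠ 0 ∧ ∀ p : PrimeSpectrum B, h ∉ p.asIdeal →
      p ∈ Set.range (PrimeSpectrum.comap f) := by
  obtain ⟨T, hT⟩ := PrimeSpectrum.exists_constructibleSetData_iff.2
    (PrimeSpectrum.isConstructible_range_comap hf)
  have generic_mem : (⟨⊥, Ideal.isPrime_bot⟩ : PrimeSpectrum B) ∈
      Set.range (PrimeSpectrum.comap f) := by
    obtain ⟨q, hq, hqe⟩ := Ideal.exists_comap_eq_of_mem_minimalPrimes_of_injective hinj
      (⊥ : Ideal B) (by rw [IsDomain.minimalPrimes_eq_singleton_bot]; rfl)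
    exact ⟨⟨q, hq⟩, PrimeSpectrum.ext hqe⟩
  rw [← hT] at generic_mem ⊢
  simp only [PrimeSpectrum.ConstructibleSetData.toSet, Set.mem_iUnion] at generic_mem ⊢
  obtain ⟨C, hC, hg, hf⟩ := generic_mem
  refine ⟨C.f, fun h => hf (by simp [h]), fun p hp => ⟨C, hC, ?_, fun h => hp (by simpa using h)⟩⟩
  rintro _ ⟨i, rfl⟩
  have : C.g i = 0 := by simpa using hg ⟨i, rfl⟩
  rw [this]
  exact zero_mem _

variable {K : Type*} [Field K] [IsAlgClosed K]

/-- Chevalley's theorem provides a prime over the kernel of `ev`, and the Nullstellensatz a rational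
point on it. -/
lemma exists_ne_zero_forall_exists_algHom_comp_eq {B S : Type*} [CommRing B] [IsDomain B]
    [IsNoetherianRing B] [Algebra K B] [CommRing S] [Algebra K S] [Algebra.FiniteType K S]
    (f : B →ₐ[K] S) (hf : Function.Injective f) :
    ∃ h : B, h ≠ 0 ∧ ∀ ev : B →ₐ[K] K, ev h ≠ 0 → ∃ g : S →ₐ[K] K, g.comp f = ev := by
  have hfin : (f : B →+* S).FinitePresentation := RingHom.FinitePresentation.of_finiteType.1 <|
    RingHom.FiniteType.of_comp_finiteType (f := algebraMap K B) <| by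
      rw [f.comp_algebraMap]
      exact RingHom.finiteType_algebraMap.2 inferInstance
  obtain ⟨h, h0, hh⟩ := exists_ne_zero_forall_mem_range_comap (f : B →+* S) hfin hf
  refine ⟨h, h0, fun ev hev => ?_⟩
  obtain ⟨Q, hQ⟩ := hh ⟨RingHom.ker ev, RingHom.ker_isPrime _⟩ hev
  obtain ⟨m, hm, hQm⟩ := Ideal.exists_le_maximal Q.asIdeal Q.isPrime.ne_top
  let _ : Field (S ⧸ m) := Ideal.Quotient.field m
  have : Module.Finite K (S ⧸ m) := finite_of_finite_type_of_isJacobsonRing K (S ⧸ m)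
  let e := AlgEquiv.ofBijective (Algebra.ofId K (S ⧸ m))
    (IsAlgClosed.algebraMap_bijective_of_isIntegral (k := K))
  let g : S →ₐ[K] K := (e.symm : (S ⧸ m) →ₐ[K] K).comp (Ideal.Quotient.mkₐ K m)
  have hker : ∀ b, ev b = 0 → g (f b) = 0 := fun b hb => by
    have : b ∈ (PrimeSpectrum.comap (f : B →+* S) Q).asIdeal := by rw [hQ]; exact hb
    have : Ideal.Quotient.mk m (f b) = 0 := Ideal.Quotient.eq_zero_iff_mem.2 (hQm this)
    simp only [g, AlgHom.comp_apply, Ideal.Quotient.mkₐ_eq_mk, this, map_zero]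
  refine ⟨g, AlgHom.ext fun b => ?_⟩
  have := hker (b - algebraMap K B (ev b)) (by simp)
  simpa [sub_eq_zero] using this

variable {σ τ : Type*}

/-- The inclusion of `K[x][t]` in `K[x, y]` with `t ↦ y_j`, used to eliminate the other `y`. -/
def singleVarInclusion (K : Type*) [Field K] (σ : Type*) {τ : Type*} (j : τ) :
    Polynomial (MvPolynomial σ K) →ₐ[K] MvPolynomial (σ ⊕ τ) K :=
  Polynomial.eval₂AlgHom (rename Sum.inl) (X (Sum.inr j)) fun _ => Commute.all _ _

lemma exists_ne_zero_forall_exists_mem_zeroLocus [Finite σ] [Finite τ]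
    {J : Ideal (MvPolynomial (σ ⊕ τ) K)} (j : τ)
    (hJ : ∀ q, singleVarInclusion K σ j q ∈ J → q = 0) :
    ∃ h : Polynomial (MvPolynomial σ K), h ≠ 0 ∧ ∀ (a : σ → K) (b : K),
      (h.map (eval a)).eval b ≠ 0 → ∃ p ∈ zeroLocus K J, p ∘ Sum.inl = a ∧ p (Sum.inr j) = b := by
  obtain ⟨h, h0, hh⟩ := exists_ne_zero_forall_exists_algHom_comp_eq
    ((Ideal.Quotient.mkₐ K J).comp (singleVarInclusion K σ j))
    ((injective_iff_map_eq_zero _).2 fun q hq => hJ q (Ideal.Quotient.eq_zero_iff_mem.1 hq))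
  refine ⟨h, h0, fun a b hab => ?_⟩
  obtain ⟨g, hg⟩ := hh (Polynomial.eval₂AlgHom (aeval a) b fun _ => Commute.all _ _)
    (by simpa [Polynomial.eval_map, aeval_eq_eval] using hab)
  have eval_point : (aeval fun i => g (Ideal.Quotient.mkₐ K J (X i))) =
      g.comp (Ideal.Quotient.mkₐ K J) := MvPolynomial.algHom_ext fun i => by simp
  refine ⟨fun i => g (Ideal.Quotient.mkₐ K J (X i)), fun q hq => ?_, funext fun l => ?_, ?_⟩
  · rw [eval_point, AlgHom.comp_apply, Ideal.Quotient.mkₐ_eq_mk,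
      Ideal.Quotient.eq_zero_iff_mem.2 hq, map_zero]
  · simpa [singleVarInclusion] using DFunLike.congr_fun hg (Polynomial.C (X l))
  · simpa [singleVarInclusion] using DFunLike.congr_fun hg Polynomial.X

lemma exists_ne_zero_singleVarInclusion_mem [Finite σ] [Finite τ]
    {J : Ideal (MvPolynomial (σ ⊕ τ) K)} {g : MvPolynomial σ K} (hg0 : g ≠ 0)
    (hg : ∀ a : σ → K, eval a g ≠ 0 → {p ∈ zeroLocus K J | p ∘ Sum.inl = a}.Finite) (j : τ) :
    ∃ q, q ≠ 0 ∧ singleVarInclusion K σ j q ∈ J := by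
  by_contra! hcon
  obtain ⟨h, h0, hh⟩ := exists_ne_zero_forall_exists_mem_zeroLocus (J := J) j
    fun q hq => by_contra fun hq0 => hcon q hq0 hq
  have : Infinite K := IsAlgClosed.instInfinite
  obtain ⟨a, ha⟩ : ∃ a, eval a (g * h.leadingCoeff) ≠ 0 := by
    by_contra! hz
    exact mul_ne_zero hg0 (Polynomial.leadingCoeff_ne_zero.2 h0)
      (MvPolynomial.funext fun a => by rw [hz a, map_zero])
  rw [map_mul] at ha
  have hmap : h.map (eval a) ≠ 0 := fun hz => right_ne_zero_of_mul ha <| by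
    rw [Polynomial.leadingCoeff, ← Polynomial.coeff_map, hz, Polynomial.coeff_zero]
  have infinite_nonroots : {b | (h.map (eval a)).eval b ≠ 0}.Infinite :=
    (Polynomial.finite_setOfPred_isRoot hmap).infinite_compl
  refine infinite_nonroots <|
    ((hg a (left_ne_zero_of_mul ha)).image fun p => p (Sum.inr j)).subset fun b hb => ?_
  obtain ⟨p, hp, hpa, hpb⟩ := hh a b hb
  exact ⟨p, ⟨hp, hpa⟩, hpb⟩

end Elimination

section LaurentElimination

variable {N M : ℕ} {K : Type*} [Field K]

lemma mixedMonomial_zero (α : Fin N → ℤ) (c : K) :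
    (mixedMonomial α 0 c : MixedRing N M K) = C (AddMonoidAlgebra.single α c) :=
  rfl

/-- The inclusion of `K[x]` in `K[x^*]`. -/
def laurentInclusion (N : ℕ) (K : Type*) [Field K] : MvPolynomial (Fin N) K →ₐ[K] LaurentRing N K :=
  AddMonoidAlgebra.mapDomainAlgHom K K
    { toFun := fun β l => (β l : ℤ), map_zero' := by ext; simp, map_add' := by intros; ext; simp }

lemma laurentInclusion_X (l : Fin N) :
    laurentInclusion N K (X l) = AddMonoidAlgebra.single (Pi.single l 1) 1 := by
  refine AddMonoidAlgebra.mapDomain_single.trans ?_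
  congr 1
  ext i
  simp [Finsupp.single_apply, Pi.single_apply, eq_comm]

lemma laurentInclusion_injective : Function.Injective (laurentInclusion N K) :=
  AddMonoidAlgebra.mapDomain_injective fun _ _ h =>
    Finsupp.ext fun l => Nat.cast_injective (R := ℤ) (congrFun h l)

lemma polyInclusion_rename_inl (a : MvPolynomial (Fin N) K) :
    polyInclusion N M K (rename Sum.inl a) = C (laurentInclusion N K a) := by
  induction a using MvPolynomial.induction_on with
  | C r => simp [← MvPolynomial.algebraMap_eq]
  | add p q hp hq => simp only [map_add, hp, hq]
  | mul_X p l hp =>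
    have hX : polyInclusion N M K (X (Sum.inl l)) =
        C (AddMonoidAlgebra.single (Pi.single l 1) 1) := by
      rw [polyInclusion, aeval_X, Sum.elim_inl, mixedMonomial_zero]
    simp only [map_mul, hp, laurentInclusion_X, rename_X, hX]

lemma aeval_mapAlgHom_laurentInclusion (j : Fin M) (q : Polynomial (MvPolynomial (Fin N) K)) :
    Polynomial.aeval (X j : MixedRing N M K) (Polynomial.mapAlgHom (laurentInclusion N K) q) =
      polyInclusion N M K (singleVarInclusion K (Fin N) j q) := by
  induction q using Polynomial.induction_on' with
  | add p q hp hq => simp only [map_add, hp, hq]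
  | monomial n a =>
    have hX : polyInclusion N M K (X (Sum.inr j)) = X j := by simp [polyInclusion]
    simp [singleVarInclusion, polyInclusion_rename_inl, hX]

lemma IsLaurentAdmissible.exists_aeval_mem [IsAlgClosed K] {I : Ideal (MixedRing N M K)}
    (hI : IsLaurentAdmissible I) (j : Fin M) :
    ∃ G : Polynomial (LaurentRing N K), G ≠ 0 ∧ Polynomial.aeval (X j : MixedRing N M K) G ∈ I := by
  obtain ⟨g, hg0, hg⟩ := hI.2
  obtain ⟨q, hq0, hq⟩ := exists_ne_zero_singleVarInclusion_mem hg0 hg j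
  refine ⟨Polynomial.mapAlgHom (laurentInclusion N K) q,
    (Polynomial.map_ne_zero_iff laurentInclusion_injective).2 hq0, ?_⟩
  rw [aeval_mapAlgHom_laurentInclusion]
  exact hq

end LaurentElimination

/-! ### The Newton–Puiseux process in one variable -/

section SupportedIn

variable {K G : Type*} [Field K] [AddCommGroup G]

/-- The elements of `K[G]` with exponents in `g + T`, the pieces of a filtration in `g`. -/
def supportedIn (K : Type*) [Field K] (T : AddSubmonoid G) (g : G) :
    AddSubgroup (AddMonoidAlgebra K G) where
  carrier := {a | ∀ α, a.coeff α ≠ 0 → α - g ∈ T}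
  zero_mem' := fun _ h => absurd rfl h
  add_mem' {a b} ha hb α h := by
    rcases ne_or_eq (a.coeff α) 0 with h' | h'
    · exact ha α h'
    · exact hb α (by simpa [h'] using h)
  neg_mem' ha α h := ha α (by simpa using h)

lemma single_mem_supportedIn {T : AddSubmonoid G} {g α : G} (h : α - g ∈ T) (c : K) :
    AddMonoidAlgebra.single α c ∈ supportedIn K T g := fun β hβ => by
  rw [AddMonoidAlgebra.coeff_single] at hβ
  rwa [show β = α from by_contra fun hne => hβ (Finsupp.single_eq_of_ne hne)]

instance (T : AddSubmonoid G) : SetLike.GradedMonoid (supportedIn K T) where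
  one_mem := single_mem_supportedIn (by rw [sub_zero]; exact zero_mem T) 1
  mul_mem g g' a b ha hb γ hγ := by
    classical
    obtain ⟨α, hα, β, hβ, rfl⟩ := Finset.mem_add.1
      (AddMonoidAlgebra.support_coeff_mul_subset a b (Finsupp.mem_support_iff.2 hγ))
    rw [add_sub_add_comm]
    exact add_mem (ha α (Finsupp.mem_support_iff.1 hα)) (hb β (Finsupp.mem_support_iff.1 hβ))

end SupportedIn

section InitialForms

variable {K G : Type*} [Field K] [AddCommGroup G]

/-- The homogeneous component of degree `δ` of `F`, for the grading in which `x ^ α y ^ k` has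
degree `α + k e`, written as a polynomial in `y`. -/
def initForm (δ e : G) (F : Polynomial (AddMonoidAlgebra K G)) : Polynomial K :=
  ∑ k ∈ F.support, Polynomial.monomial k ((F.coeff k).coeff (δ - k • e))

lemma coeff_initForm (δ e : G) (F : Polynomial (AddMonoidAlgebra K G)) (k : ℕ) :
    (initForm δ e F).coeff k = (F.coeff k).coeff (δ - k • e) := by
  rw [initForm, Polynomial.finsetSum_coeff]
  simp only [Polynomial.coeff_monomial]
  rw [Finset.sum_ite_eq']
  split_ifs with h
  · rfl
  · rw [Polynomial.notMem_support_iff.1 h]; rfl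

lemma initForm_add (δ e : G) (F H : Polynomial (AddMonoidAlgebra K G)) :
    initForm δ e (F + H) = initForm δ e F + initForm δ e H := by
  ext k
  simp [coeff_initForm]

lemma initForm_monomial (δ e : G) (k : ℕ) (a : AddMonoidAlgebra K G) :
    initForm δ e (Polynomial.monomial k a) = Polynomial.monomial k (a.coeff (δ - k • e)) := by
  ext j
  rw [coeff_initForm, Polynomial.coeff_monomial, Polynomial.coeff_monomial]
  split_ifs with h
  · rw [h]
  · rfl

lemma initForm_taylor (δ e : G) (c : K) (F : Polynomial (AddMonoidAlgebra K G)) :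
    initForm δ e (Polynomial.taylor (AddMonoidAlgebra.single e c) F) =
      Polynomial.taylor c (initForm δ e F) := by
  induction F using Polynomial.induction_on' with
  | add F H hF hH => rw [map_add, initForm_add, hF, hH, initForm_add, map_add]
  | monomial k a =>
    rw [initForm_monomial]
    ext j
    rw [coeff_initForm, Polynomial.taylor_monomial, Polynomial.taylor_monomial,
      Polynomial.coeff_C_mul, Polynomial.coeff_C_mul, Polynomial.coeff_X_add_C_pow,
      Polynomial.coeff_X_add_C_pow, AddMonoidAlgebra.single_pow, AddMonoidAlgebra.natCast_def,
      AddMonoidAlgebra.single_mul_single, AddMonoidAlgebra.coeff_mul_single_apply]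
    rcases le_or_gt j k with h | h
    · congr 2
      have : k • e = (k - j) • e + j • e := by rw [← add_nsmul, Nat.sub_add_cancel h]
      rw [this]; abel
    · simp [Nat.choose_eq_zero_of_lt h]

/-- `δ` is an exponent of least weight in `F`, for the grading in which `x ^ α y ^ k` has degree
`α + k e`; the corresponding component `initForm δ e F` is the initial form of `F`. -/
def IsInitExp (w : G →+ ℝ) (e : G) (F : Polynomial (AddMonoidAlgebra K G)) (δ : G) : Prop :=
  initForm δ e F ≠ 0 ∧ ∀ k α, (F.coeff k).coeff α ≠ 0 → w δ ≤ w (α + k • e)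

variable {w : G →+ ℝ} {e e' δ δ' : G} {F : Polynomial (AddMonoidAlgebra K G)}

lemma exists_isInitExp (w : G →+ ℝ) (e : G) (hF : F ≠ 0) : ∃ δ, IsInitExp w e F δ := by
  classical
  let degrees : Finset G :=
    F.support.biUnion fun k => (F.coeff k).coeff.support.image (· + k • e)
  have mem_degrees : ∀ k α, (F.coeff k).coeff α ≠ 0 → α + k • e ∈ degrees := fun k α h =>
    Finset.mem_biUnion.2 ⟨k, Polynomial.mem_support_iff.2 fun h0 => h (by rw [h0]; rfl),
      Finset.mem_image_of_mem _ (Finsupp.mem_support_iff.2 h)⟩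
  have nonempty_degrees : degrees.Nonempty := by
    obtain ⟨k, hk⟩ := Polynomial.support_nonempty.2 hF
    obtain ⟨α, hα⟩ := Finsupp.ne_iff.1 (AddMonoidAlgebra.coeff_eq_zero.not.2
      (Polynomial.mem_support_iff.1 hk))
    exact ⟨_, mem_degrees k α hα⟩
  obtain ⟨δ, hδ, hmin⟩ := degrees.exists_min_image w nonempty_degrees
  refine ⟨δ, fun h0 => ?_, fun k α h => hmin _ (mem_degrees k α h)⟩
  obtain ⟨k, -, h⟩ := Finset.mem_biUnion.1 hδ
  obtain ⟨α, hα, rfl⟩ := Finset.mem_image.1 h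
  refine Finsupp.mem_support_iff.1 hα ?_
  simpa [coeff_initForm] using congrArg (Polynomial.coeff · k) h0

lemma IsInitExp.taylor (h : IsInitExp w e F δ) (c : K) :
    IsInitExp w e (Polynomial.taylor (AddMonoidAlgebra.single e c) F) δ := by
  refine ⟨?_, fun k α hα => ?_⟩
  · rw [initForm_taylor, Ne, Polynomial.taylor_eq_zero]
    exact h.1
  · have hform : initForm (α + k • e) e F ≠ 0 := fun h0 => by
      have := congrArg (Polynomial.coeff · k) (initForm_taylor (α + k • e) e c F)
      rw [h0, map_zero] at this
      exact hα (by simpa [coeff_initForm] using this)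
    obtain ⟨l, hl⟩ := Polynomial.support_nonempty.2 hform
    rw [Polynomial.mem_support_iff, coeff_initForm] at hl
    simpa using h.2 l _ hl

lemma IsInitExp.natDegree_le (h : IsInitExp w e F δ) (h' : IsInitExp w e' F δ') (hlt : w e < w e')
    {m : ℕ} (hm : (initForm δ e F).coeff m ≠ 0) : (initForm δ' e' F).natDegree ≤ m := by
  refine Polynomial.natDegree_le_iff_coeff_eq_zero.2 fun k hk => ?_
  by_contra hne
  rw [coeff_initForm] at hm hne
  have h1 := h.2 k _ hne
  have h2 := h'.2 m _ hm
  simp only [map_add, map_sub, map_nsmul, nsmul_eq_mul] at h1 h2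
  have h3 : (m : ℝ) < k := by exact_mod_cast hk
  nlinarith

lemma IsInitExp.weight_sub_eq (h : IsInitExp w e F δ) (h' : IsInitExp w e' F δ') {m : ℕ}
    (hm : (initForm δ e F).coeff m ≠ 0) (hm' : (initForm δ' e' F).coeff m ≠ 0) :
    w (δ - m • e) = w (δ' - m • e') := by
  rw [coeff_initForm] at hm hm'
  have h1 := h.2 m _ hm'
  have h2 := h'.2 m _ hm
  simp only [map_add, map_sub, map_nsmul] at h1 h2 ⊢
  linarith

end InitialForms

section RootMultiplicity

variable {K : Type*} [Field K] {f : Polynomial K}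

lemma coeff_taylor_rootMultiplicity_ne_zero (hf : f ≠ 0) (c : K) :
    (Polynomial.taylor c f).coeff (f.rootMultiplicity c) ≠ 0 := by
  rw [Polynomial.rootMultiplicity_eq_natTrailingDegree, ← Polynomial.taylor_apply]
  exact Polynomial.trailingCoeff_nonzero_iff_nonzero.2 ((Polynomial.taylor_eq_zero c f).not.2 hf)

lemma coeff_natDegree_sub_one_ne_zero [CharZero K] {c : K} (hf : f ≠ 0) (hc : c ≠ 0)
    (h : f.rootMultiplicity c = f.natDegree) (h1 : 1 ≤ f.natDegree) :
    f.coeff (f.natDegree - 1) ≠ 0 := by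
  classical
  have roots_eq : Multiset.replicate f.natDegree c = f.roots :=
    Multiset.eq_of_le_of_card_le
      (Multiset.le_count_iff_replicate_le.1 (by rw [Polynomial.count_roots, h]))
      (by rw [Multiset.card_replicate]; exact f.card_roots')
  have splits : f.Splits := Polynomial.splits_iff_card_roots.2 <| by
    rw [← roots_eq, Multiset.card_replicate]
  rw [← Polynomial.nextCoeff_of_natDegree_pos h1,
    splits.nextCoeff_eq_neg_sum_roots_mul_leadingCoeff, ← roots_eq, Multiset.sum_replicate,
    nsmul_eq_mul]
  exact mul_ne_zero (neg_ne_zero.2 (Polynomial.leadingCoeff_ne_zero.2 hf))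
    (mul_ne_zero (Nat.cast_ne_zero.2 (by lia)) hc)

end RootMultiplicity

section NewtonSequences

variable {K G : Type*} [Field K] [AddCommGroup G]

/-- The sum of the first `i` terms `c_k x ^ e_k` of a series with terms in `K[G]`. -/
def truncation (e : ℕ → G) (c : ℕ → K) (i : ℕ) : AddMonoidAlgebra K G :=
  ∑ k ∈ Finset.range i, AddMonoidAlgebra.single (e k) (c k)

/-- The terms `c_i x ^ e_i` are produced by the Newton–Puiseux process for the equation `F = 0`:
substituting the next term of the series cancels the part of least weight of the equation. -/
structure IsNewtonSequence (w : G →+ ℝ) (F : Polynomial (AddMonoidAlgebra K G)) (e : ℕ → G)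
    (c : ℕ → K) : Prop where
  coeff_ne_zero : ∀ i, c i ≠ 0
  weight_lt : ∀ i, w (e i) < w (e (i + 1))
  cancels : ∀ i γ, (F.eval (truncation e c (i + 1))).coeff γ ≠ 0 → ∃ k α,
    ((Polynomial.taylor (truncation e c i) F).coeff k).coeff α ≠ 0 ∧ w (α + k • e i) < w γ

variable {w : G →+ ℝ} {F : Polynomial (AddMonoidAlgebra K G)} {e : ℕ → G} {c : ℕ → K}

lemma taylor_truncation_succ (e : ℕ → G) (c : ℕ → K) (i : ℕ) :
    Polynomial.taylor (truncation e c (i + 1)) F =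
      Polynomial.taylor (AddMonoidAlgebra.single (e i) (c i))
        (Polynomial.taylor (truncation e c i) F) := by
  rw [Polynomial.taylor_taylor, truncation, Finset.sum_range_succ, add_comm, truncation]

namespace IsNewtonSequence

lemma isRoot_initForm (h : IsNewtonSequence w F e c) {i : ℕ} {δ : G}
    (hδ : IsInitExp w (e i) (Polynomial.taylor (truncation e c i) F) δ) :
    (initForm δ (e i) (Polynomial.taylor (truncation e c i) F)).IsRoot (c i) := by
  by_contra hroot
  rw [Polynomial.IsRoot, ← Polynomial.taylor_coeff_zero, ← initForm_taylor,
    ← taylor_truncation_succ, coeff_initForm, Polynomial.taylor_coeff_zero, zero_nsmul,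
    sub_zero] at hroot
  obtain ⟨k, α, hα, hlt⟩ := h.cancels i _ hroot
  exact (hδ.2 k α hα).not_gt hlt

lemma natDegree_initForm_succ_le (h : IsNewtonSequence w F e c) {i : ℕ} {δ δ' : G}
    (hδ : IsInitExp w (e i) (Polynomial.taylor (truncation e c i) F) δ)
    (hδ' : IsInitExp w (e (i + 1)) (Polynomial.taylor (truncation e c (i + 1)) F) δ') :
    (initForm δ' (e (i + 1)) (Polynomial.taylor (truncation e c (i + 1)) F)).natDegree ≤
      (initForm δ (e i) (Polynomial.taylor (truncation e c i) F)).rootMultiplicity (c i) := by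
  rw [taylor_truncation_succ] at hδ' ⊢
  refine (hδ.taylor (c i)).natDegree_le hδ' (h.weight_lt i) ?_
  rw [initForm_taylor]
  exact coeff_taylor_rootMultiplicity_ne_zero hδ.1 _

lemma exists_stable (h : IsNewtonSequence w F e c) (hw : Function.Injective w) (hF : F ≠ 0) :
    ∃ (s μ : ℕ) (β : G), 1 ≤ μ ∧ ∀ i, s ≤ i →
      IsInitExp w (e i) (Polynomial.taylor (truncation e c i) F) (β + μ • e i) ∧
      (initForm (β + μ • e i) (e i) (Polynomial.taylor (truncation e c i) F)).natDegree = μ ∧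
      (initForm (β + μ • e i) (e i)
        (Polynomial.taylor (truncation e c i) F)).rootMultiplicity (c i) = μ := by
  choose δ hδ using fun i => exists_isInitExp w (e i)
    ((Polynomial.taylor_eq_zero (truncation e c i) F).not.2 hF)
  let f : ℕ → Polynomial K := fun i =>
    initForm (δ i) (e i) (Polynomial.taylor (truncation e c i) F)
  let m : ℕ → ℕ := fun i => (f i).rootMultiplicity (c i)
  have mult_le_natDegree : ∀ i, m i ≤ (f i).natDegree := fun i => by
    rw [← Polynomial.natDegree_taylor (f i) (c i)]
    exact Polynomial.le_natDegree_of_ne_zero (coeff_taylor_rootMultiplicity_ne_zero (hδ i).1 _)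
  have natDegree_le_mult : ∀ i, (f (i + 1)).natDegree ≤ m i := fun i =>
    h.natDegree_initForm_succ_le (hδ i) (hδ (i + 1))
  obtain ⟨n, hn⟩ := WellFoundedLT.antitone_chain_condition (f := m) <|
    antitone_nat_of_succ_le fun i => (mult_le_natDegree (i + 1)).trans (natDegree_le_mult i)
  have mult_eq : ∀ i, n ≤ i → m i = m n := fun i hi => (hn i hi).symm
  have natDegree_eq : ∀ i, n + 1 ≤ i → (f i).natDegree = m n := fun i hi => by
    obtain ⟨i, rfl⟩ := Nat.exists_eq_add_of_le' (Nat.le_of_add_left_le hi)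
    exact le_antisymm ((natDegree_le_mult i).trans (mult_eq i (by lia)).le)
      ((mult_eq (i + 1) (by lia)).ge.trans (mult_le_natDegree _))
  have offset_eq : ∀ i, n + 1 ≤ i → δ i - m n • e i = δ (n + 1) - m n • e (n + 1) := fun i hi => by
    induction i, hi using Nat.le_induction with
    | base => rfl
    | succ i hi ih =>
      have hi' := (hδ i).taylor (c i)
      rw [← taylor_truncation_succ] at hi'
      rw [← ih]
      refine hw ((hδ (i + 1)).weight_sub_eq hi' ?_ ?_)
      · rw [← natDegree_eq (i + 1) (by lia)]
        exact Polynomial.leadingCoeff_ne_zero.2 (hδ (i + 1)).1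
      · rw [taylor_truncation_succ, initForm_taylor, ← mult_eq i (by lia)]
        exact coeff_taylor_rootMultiplicity_ne_zero (hδ i).1 _
  refine ⟨n + 1, m n, δ (n + 1) - m n • e (n + 1),
    (Polynomial.rootMultiplicity_pos (hδ n).1).2 (h.isRoot_initForm (hδ n)), fun i hi => ?_⟩
  rw [← offset_eq i hi, sub_add_cancel]
  exact ⟨hδ i, natDegree_eq i hi, mult_eq i (by lia)⟩

end IsNewtonSequence

lemma polynomial_eval_mem {R σ ι : Type*} [CommSemiring R] [AddCommGroup ι] [SetLike σ R]
    [AddSubmonoidClass σ R] {A : ι → σ} [SetLike.GradedMonoid A] {Q : Polynomial R} {a : R}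
    {g β : ι} (hQ : ∀ k, Q.coeff k ∈ A (β - k • g)) (ha : a ∈ A g) : Q.eval a ∈ A β := by
  rw [Polynomial.eval_eq_sum]
  refine sum_mem fun k _ => ?_
  simpa only [sub_add_cancel] using SetLike.mul_mem_graded (hQ k) (SetLike.pow_mem_graded k ha)

lemma sub_mem_of_coeff_eval_truncation_ne_zero {T : AddSubmonoid G}
    {Q : Polynomial (AddMonoidAlgebra K G)} {β : G} {s : ℕ}
    (hQ : ∀ k, Q.coeff k ∈ supportedIn K T (β + e s - k • e s))
    (hcoeff : ∀ i, s ≤ i → (Q.eval (truncation e c i - truncation e c s)).coeff (β + e i) ≠ 0)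
    {i : ℕ} (hi : s ≤ i) : e i - e s ∈ T := by
  induction i using Nat.strong_induction_on with
  | _ i ih =>
    have tail_mem : truncation e c i - truncation e c s ∈ supportedIn K T (e s) := by
      rw [truncation, truncation, ← Finset.sum_Ico_eq_sub _ hi]
      refine sum_mem fun k hk => single_mem_supportedIn ?_ _
      exact ih k (Finset.mem_Ico.1 hk).2 (Finset.mem_Ico.1 hk).1
    simpa only [add_sub_add_left_eq_sub] using polynomial_eval_mem hQ tail_mem _ (hcoeff i hi)

lemma coeff_taylor_hasseDeriv {R : Type*} [CommRing R] (p : R) (F : Polynomial R) (n k : ℕ) :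
    (Polynomial.taylor p (Polynomial.hasseDeriv n F)).coeff k =
      (k + n).choose k • (Polynomial.taylor p F).coeff (k + n) := by
  rw [Polynomial.taylor_coeff, ← LinearMap.comp_apply, Polynomial.hasseDeriv_comp,
    LinearMap.smul_apply, Polynomial.eval_smul, Polynomial.taylor_coeff]

/-- Once the multiplicity `μ` of the roots is stable, the `(μ - 1)`-st Hasse derivative of `F` is a
regular equation for the rest of the series. -/
theorem IsNewtonSequence.exists_sub_mem_closure [CharZero K] (h : IsNewtonSequence w F e c)
    (hw : Function.Injective w) (hF : F ≠ 0) :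
    ∃ (s : ℕ) (T : Finset G), (∀ t ∈ T, 0 ≤ w t) ∧
      ∀ i, s ≤ i → e i - e s ∈ AddSubmonoid.closure (T : Set G) := by
  classical
  obtain ⟨s, μ, β, hμ, hstable⟩ := h.exists_stable hw hF
  let Q := Polynomial.taylor (truncation e c s) (Polynomial.hasseDeriv (μ - 1) F)
  let T : Finset G := Q.support.biUnion fun k =>
    (Q.coeff k).coeff.support.image fun α => α - (β + e s - k • e s)
  have mem_T : ∀ k α, (Q.coeff k).coeff α ≠ 0 → α - (β + e s - k • e s) ∈ T := fun k α hα =>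
    Finset.mem_biUnion.2 ⟨k, Polynomial.mem_support_iff.2 fun h0 => hα (by rw [h0]; rfl),
      Finset.mem_image_of_mem _ (Finsupp.mem_support_iff.2 hα)⟩
  have weight_nonneg : ∀ k α, (Q.coeff k).coeff α ≠ 0 → 0 ≤ w (α - (β + e s - k • e s)) := by
    intro k α hα
    rw [coeff_taylor_hasseDeriv] at hα
    have hF' := (hstable s le_rfl).1.2 (k + (μ - 1)) α fun h0 => hα <| by
      rw [AddMonoidAlgebra.coeff_smul, Finsupp.smul_apply, h0, smul_zero]
    have hμ' : ((μ - 1 : ℕ) : ℝ) = μ - 1 := by rw [Nat.cast_sub hμ, Nat.cast_one]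
    simp only [map_add, map_sub, map_nsmul, nsmul_eq_mul, Nat.cast_add, hμ'] at hF' ⊢
    linarith
  have coeff_ne_zero : ∀ i, s ≤ i →
      (Q.eval (truncation e c i - truncation e c s)).coeff (β + e i) ≠ 0 := by
    intro i hi
    obtain ⟨hinit, hdeg, hmult⟩ := hstable i hi
    have := coeff_natDegree_sub_one_ne_zero hinit.1 (h.coeff_ne_zero i) (hmult.trans hdeg.symm)
      (by rwa [hdeg])
    rw [hdeg, coeff_initForm, Polynomial.taylor_coeff] at this
    obtain ⟨m, rfl⟩ := Nat.exists_eq_add_of_le' hμ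
    rwa [Polynomial.taylor_eval_sub, show β + e i = β + (m + 1) • e i - (m + 1 - 1) • e i by
      rw [Nat.add_sub_cancel, succ_nsmul, ← add_assoc, add_sub_right_comm, add_sub_cancel_right]]
  refine ⟨s, T, fun t ht => ?_, fun i => sub_mem_of_coeff_eval_truncation_ne_zero
    (fun k α hα => AddSubmonoid.subset_closure (mem_T k α hα)) coeff_ne_zero⟩
  obtain ⟨k, -, ht⟩ := Finset.mem_biUnion.1 ht
  obtain ⟨α, hα, rfl⟩ := Finset.mem_image.1 ht
  exact weight_nonneg k α (Finsupp.mem_support_iff.1 hα)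

end NewtonSequences

/-! ### Monomial substitutions -/

section FracRing

variable {N M : ℕ} {K : Type*} [Field K]

/-- The ring of Laurent polynomials with rational exponents, where the substitutions
`x ↦ x ^ {r I}` for rational `r` take place. -/
abbrev FracRing (N : ℕ) (K : Type*) [Field K] : Type _ := AddMonoidAlgebra K (Fin N → ℚ)

/-- The weight `α ↦ ω · α`, as a homomorphism. -/
def omegaHom (ω : Fin N → ℝ) : (Fin N → ℚ) →+ ℝ where
  toFun := omegaDot ω
  map_zero' := by simp [omegaDot]
  map_add' a b := omegaDot_add ω a b

lemma omegaHom_injective {ω : Fin N → ℝ} (hω : LinearIndependent ℚ ω) :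
    Function.Injective (omegaHom ω) := by
  rw [injective_iff_map_eq_zero]
  intro a ha
  funext l
  refine Fintype.linearIndependent_iff.1 hω a ?_ l
  rw [← ha]
  exact Finset.sum_congr rfl fun i _ => by rw [Rat.smul_def, mul_comm]

lemma omegaHom_smul (ω : Fin N → ℝ) (r : ℚ) (a : Fin N → ℚ) :
    omegaHom ω (r • a) = r * omegaHom ω a := by
  rw [map_rat_smul (omegaHom ω), Rat.smul_def]

/-- The exponent `r α`, for an integral exponent `α`. -/
def scaleHom (N : ℕ) (r : ℚ) : (Fin N → ℤ) →+ (Fin N → ℚ) where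
  toFun α := r • fun l => (α l : ℚ)
  map_zero' := by ext; simp
  map_add' a b := by ext; simp [mul_add]

/-- The substitution `x ↦ x ^ {r I}`, from Laurent polynomials to fractional ones. -/
def fracEmb (N : ℕ) (K : Type*) [Field K] (r : ℚ) : LaurentRing N K →+* FracRing N K :=
  AddMonoidAlgebra.mapDomainRingHom K (scaleHom N r)

lemma fracEmb_single (r : ℚ) (α : Fin N → ℤ) (a : K) :
    fracEmb N K r (AddMonoidAlgebra.single α a) = AddMonoidAlgebra.single (scaleHom N r α) a :=
  AddMonoidAlgebra.mapDomain_single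

lemma scaleHom_injective {r : ℚ} (hr : r ≠ 0) : Function.Injective (scaleHom N r) := fun a b h =>
  funext fun l => by simpa [scaleHom, hr] using congrFun h l

lemma fracEmb_injective {r : ℚ} (hr : r ≠ 0) : Function.Injective (fracEmb N K r) :=
  AddMonoidAlgebra.mapDomain_injective (scaleHom_injective hr)

lemma fracEmb_comp_ramify (r : ℚ) (d : ℕ) :
    (fracEmb N K r).comp (ramify N K d) = fracEmb N K (r * d) := by
  rw [fracEmb, ramify, ← AddMonoidAlgebra.mapDomainRingHom_comp, fracEmb]
  congr 1
  ext α l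
  simp [scaleHom, mul_assoc]

namespace OmegaData

/-- The `i`-th row of `Γ`, with `0` in place of `∞`. -/
def exponent {K : Type*} (D : OmegaData N M K) (i : Fin M) : Fin N → ℚ :=
  fun l => (D.Γ i l).untopD 0

/-- The monomial `c_i x ^ {r Γ_i}`, as a fractional Laurent polynomial. -/
def term (D : OmegaData N M K) (r : ℚ) (i : Fin M) : FracRing N K :=
  AddMonoidAlgebra.single (r • D.exponent i) (D.c i)

lemma d_pos {K : Type*} (D : OmegaData N M K) : 0 < D.d :=
  Nat.pos_of_ne_zero (Finset.lcm_ne_zero_iff.2 fun _ _ => Rat.den_nz _)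

lemma num_d_mul {K : Type*} (D : OmegaData N M K) (i : Fin M) (l : Fin N) :
    ((((D.d : ℚ) * (D.Γ i l).untopD 0).num : ℤ) : ℚ) = D.d * D.exponent i l := by
  obtain ⟨m, hm⟩ : ((D.Γ i l).untopD 0).den ∣ D.d :=
    Finset.dvd_lcm (f := fun p : Fin M × Fin N => ((D.Γ p.1 p.2).untopD 0).den)
      (Finset.mem_univ (i, l))
  have isInt : (D.d : ℚ) * (D.Γ i l).untopD 0 = ((m * ((D.Γ i l).untopD 0).num : ℤ) : ℚ) := by
    rw [hm]
    push_cast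
    linear_combination (m : ℚ) * Rat.mul_den_eq_num ((D.Γ i l).untopD 0)
  rw [isInt, Rat.num_intCast, ← isInt, exponent]

lemma eval₂_subst {R : Type*} [CommRing R] (D : OmegaData N M K) (g : FracRing N K →+* R) (r : ℚ)
    (y : Fin M → R) (f : MixedRing N M K) :
    eval₂ (g.comp (fracEmb N K r)) y (D.subst f) =
      eval₂ (g.comp (fracEmb N K (r * D.d))) (fun j => y j + g (D.term (r * D.d) j)) f := by
  suffices (eval₂Hom (g.comp (fracEmb N K r)) y).comp D.subst =
      eval₂Hom (g.comp (fracEmb N K (r * D.d))) (fun j => y j + g (D.term (r * D.d) j)) from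
    RingHom.congr_fun this f
  refine MvPolynomial.ringHom_ext (fun a => ?_) (fun j => ?_)
  · simp only [subst, RingHom.comp_apply, eval₂Hom_C]
    rw [← fracEmb_comp_ramify, RingHom.comp_apply]
  · simp only [subst, RingHom.comp_apply, eval₂Hom_X', map_add, mixedMonomial_zero, eval₂Hom_C,
      fracEmb_single, term]
    congr 3
    ext l
    simp only [scaleHom, AddMonoidHom.coe_mk, ZeroHom.coe_mk, Pi.smul_apply, smul_eq_mul,
      D.num_d_mul, mul_assoc]

end OmegaData

end FracRing

/-! ### Starting `ω`-sets -/

section Starting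

variable {N M : ℕ} {K : Type*} [Field K] {ω : Fin N → ℝ} {D : OmegaData N M K}

lemma IsOmegaSet.eta_eq (hω : LinearIndependent ℚ ω) (hD : IsOmegaSet ω D) {j : Fin M}
    (hj : D.η j ≠ ⊤) : D.η j = ((omegaHom ω (D.exponent j) : ℝ) : WithTop ℝ) := by
  have row_ne_top : ∀ l, D.Γ j l ≠ ⊤ := fun l hl => hj <| by
    rw [← hD.1 j]
    refine WithTop.sum_eq_top.2 ⟨l, Finset.mem_univ l, ?_⟩
    rw [hl, WithTop.map_top]
    exact WithTop.mul_top (by exact_mod_cast hω.ne_zero l)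
  rw [← hD.1 j]
  change _ = ((∑ l, ω l * (D.exponent j l : ℝ) : ℝ) : WithTop ℝ)
  rw [WithTop.coe_sum]
  refine Finset.sum_congr rfl fun l _ => ?_
  obtain ⟨q, hq⟩ := WithTop.ne_top_iff_exists.1 (row_ne_top l)
  rw [OmegaData.exponent, ← hq]
  simp

/-- The exponent of `x ^ α y ^ β` evaluated at `y = 𝔐_D(x)`. -/
def OmegaData.totalExponent {K : Type*} (D : OmegaData N M K) (α : Fin N → ℤ) (β : Fin M →₀ ℕ) :
    Fin N → ℚ :=
  scaleHom N 1 α + ∑ j, β j • D.exponent j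

lemma OmegaData.smul_totalExponent {K : Type*} (D : OmegaData N M K) (r : ℚ) (α : Fin N → ℤ)
    (β : Fin M →₀ ℕ) :
    r • D.totalExponent α β = scaleHom N r α + ∑ j, β j • r • D.exponent j := by
  rw [totalExponent, smul_add, Finset.smul_sum]
  congr 1
  · simp [scaleHom]
  · exact Finset.sum_congr rfl fun j _ => smul_comm _ _ _

lemma IsOmegaSet.mixedWeight_eq (hω : LinearIndependent ℚ ω) (hD : IsOmegaSet ω D)
    (α : Fin N → ℤ) {β : Fin M →₀ ℕ} (hβ : ∏ j, D.c j ^ β j ≠ 0) :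
    mixedWeight ω D.η α β = ((omegaHom ω (D.totalExponent α β) : ℝ) : WithTop ℝ) := by
  rw [mixedWeight, OmegaData.totalExponent, map_add, map_sum, WithTop.coe_add]
  congr 1
  · rw [WithTop.coe_eq_coe]
    change _ = ∑ l, ω l * ((1 * (α l : ℚ) : ℚ) : ℝ)
    simp only [one_mul, Rat.cast_intCast]
  · rw [WithTop.coe_sum]
    refine Finset.sum_congr rfl fun j _ => ?_
    rcases Nat.eq_zero_or_pos (β j) with h | h
    · simp [h]
    · have hc : D.c j ≠ 0 := ne_zero_pow h.ne' (Finset.prod_ne_zero_iff.1 hβ j (Finset.mem_univ j))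
      rw [hD.eta_eq hω ((hD.2.2 j).1 hc), map_nsmul, nsmul_eq_mul, mul_comm, WithTop.coe_mul]

lemma eq_zero_of_mixedWeight_ne_top {η : Fin M → WithTop ℝ} {α : Fin N → ℤ} {β : Fin M →₀ ℕ}
    (h : mixedWeight ω η α β ≠ ⊤) (j : Fin M) (hj : η j = ⊤) : β j = 0 := by
  by_contra h0
  refine h (WithTop.add_eq_top.2 (Or.inr (WithTop.sum_eq_top.2 ⟨j, Finset.mem_univ j, ?_⟩)))
  rw [hj]
  exact WithTop.top_mul (by exact_mod_cast h0)

lemma IsOmegaSet.prod_pow_ne_zero (hD : IsOmegaSet ω D) {β : Fin M →₀ ℕ}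
    (hβ : ∀ j, D.η j = ⊤ → β j = 0) : ∏ j, D.c j ^ β j ≠ 0 := by
  refine Finset.prod_ne_zero_iff.2 fun j _ => ?_
  rcases eq_or_ne (D.η j) ⊤ with hj | hj
  · rw [hβ j hj, pow_zero]
    exact one_ne_zero
  · exact pow_ne_zero _ ((hD.2.2 j).2 hj)

lemma OmegaData.eval₂_term (D : OmegaData N M K) (r : ℚ) (f : MixedRing N M K) :
    eval₂ (fracEmb N K r) (D.term r) f = ∑ β ∈ f.support, ∑ α ∈ (coeff β f).coeff.support,
      AddMonoidAlgebra.single (r • D.totalExponent α β)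
        ((coeff β f).coeff α * ∏ j, D.c j ^ β j) := by
  rw [eval₂_eq']
  refine Finset.sum_congr rfl fun β _ => ?_
  conv_lhs => rw [← AddMonoidAlgebra.sum_coeff_single (coeff β f), Finsupp.sum, map_sum]
  rw [Finset.sum_mul]
  refine Finset.sum_congr rfl fun α _ => ?_
  simp only [term, AddMonoidAlgebra.single_pow, AddMonoidAlgebra.prod_single, fracEmb_single,
    AddMonoidAlgebra.single_mul_single]
  congr 1
  ext l
  simp [totalExponent, scaleHom, mul_add, Finset.mul_sum]

lemma eval₂_evalOne_mixedMonomial (c : Fin M → K) (α : Fin N → ℤ) (β : Fin M →₀ ℕ) (a : K) :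
    eval₂ (evalOne N K : LaurentRing N K →+* K) c (mixedMonomial α β a) = a * ∏ j, c j ^ β j := by
  rw [mixedMonomial, eval₂_monomial, Finsupp.prod_fintype _ _ fun j => pow_zero _, evalOne,
    RingHom.coe_coe, AddMonoidAlgebra.lift_single]
  simp

lemma IsOmegaSet.coeff_eval₂_term (hω : LinearIndependent ℚ ω) (hD : IsOmegaSet ω D) {r : ℚ}
    (hr : r ≠ 0) {f : MixedRing N M K} {v : ℝ} (hv : mixedOrder ω D.η f = (v : WithTop ℝ))
    {γ : Fin N → ℚ} (hγ : omegaHom ω γ = r * v) :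
    (eval₂ (fracEmb N K r) (D.term r) f).coeff γ =
      eval₂ (evalOne N K : LaurentRing N K →+* K) D.c (initialPart ω D.η f) := by
  classical
  rw [initialPart, if_neg (by rw [hv]; exact WithTop.coe_ne_top), D.eval₂_term,
    AddMonoidAlgebra.coeff_sum, Finsupp.finsetSum_apply, ← coe_eval₂Hom, map_sum]
  refine Finset.sum_congr rfl fun β _ => ?_
  rw [AddMonoidAlgebra.coeff_sum, Finsupp.finsetSum_apply, map_sum]
  refine Finset.sum_congr rfl fun α _ => ?_
  rw [AddMonoidAlgebra.coeff_single, apply_ite (eval₂Hom _ _), map_zero, coe_eval₂Hom,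
    eval₂_evalOne_mixedMonomial, Finsupp.single_apply]
  by_cases h0 : ∏ j, D.c j ^ β j = 0
  · simp [h0]
  · refine if_congr ?_ rfl rfl
    rw [hD.mixedWeight_eq hω α h0, hv, WithTop.coe_eq_coe, ← (omegaHom_injective hω).eq_iff,
      omegaHom_smul, hγ]
    exact mul_right_inj' (Rat.cast_ne_zero.2 hr)

lemma mixedOrder_le {η : Fin M → WithTop ℝ} {f : MixedRing N M K} {α : Fin N → ℤ}
    {β : Fin M →₀ ℕ} (h : (coeff β f).coeff α ≠ 0) :
    mixedOrder ω η f ≤ mixedWeight ω η α β := by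
  have hβ : β ∈ f.support := mem_support_iff.2 fun h0 => h (by rw [h0]; rfl)
  exact (Finset.inf_le hβ).trans (Finset.inf_le (Finsupp.mem_support_iff.2 h))

lemma mixedOrder_lt_iff {η : Fin M → WithTop ℝ} {f : MixedRing N M K} {v : WithTop ℝ} :
    mixedOrder ω η f < v ↔ ∃ β α, (coeff β f).coeff α ≠ 0 ∧ mixedWeight ω η α β < v := by
  simp only [mixedOrder, Finset.inf_lt_iff, Finsupp.mem_support_iff]
  refine ⟨fun ⟨β, _, α, hα⟩ => ⟨β, α, hα⟩, fun ⟨β, α, hα, hlt⟩ => ⟨β, ?_, α, hα, hlt⟩⟩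
  exact mem_support_iff.2 fun h0 => hα (by rw [h0]; rfl)

/-- `𝔐_D` cancels the initial part of `f`: the exponents of `f(x ^ {r I}, 𝔐_D(x ^ {r I}))` have
weight larger than `r` times the order of `f`. -/
def OmegaData.CancelsInitial (ω : Fin N → ℝ) (D : OmegaData N M K) (r : ℚ)
    (f : MixedRing N M K) : Prop :=
  ∀ γ, (eval₂ (fracEmb N K r) (D.term r) f).coeff γ ≠ 0 →
    mixedOrder ω D.η f < ((omegaHom ω γ / r : ℝ) : WithTop ℝ)

lemma OmegaData.exists_of_coeff_eval₂_term_ne_zero {r : ℚ} {f : MixedRing N M K} {γ : Fin N → ℚ}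
    (hγ : (eval₂ (fracEmb N K r) (D.term r) f).coeff γ ≠ 0) :
    ∃ β α, (coeff β f).coeff α ≠ 0 ∧ ∏ j, D.c j ^ β j ≠ 0 ∧ r • D.totalExponent α β = γ := by
  classical
  rw [D.eval₂_term, AddMonoidAlgebra.coeff_sum, Finsupp.finsetSum_apply] at hγ
  obtain ⟨β, -, hβ⟩ := Finset.exists_ne_zero_of_sum_ne_zero hγ
  rw [AddMonoidAlgebra.coeff_sum, Finsupp.finsetSum_apply] at hβ
  obtain ⟨α, -, hα⟩ := Finset.exists_ne_zero_of_sum_ne_zero hβ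
  rw [AddMonoidAlgebra.coeff_single, Finsupp.single_apply, ite_ne_right_iff] at hα
  exact ⟨β, α, left_ne_zero_of_mul hα.2, right_ne_zero_of_mul hα.2, hα.1⟩

lemma exists_of_eval₂_initialPart_ne_zero {η : Fin M → WithTop ℝ} {c : Fin M → K}
    {f : MixedRing N M K}
    (hne : eval₂ (evalOne N K : LaurentRing N K →+* K) c (initialPart ω η f) ≠ 0) :
    ∃ β α, ∏ j, c j ^ β j ≠ 0 ∧ mixedWeight ω η α β = mixedOrder ω η f := by
  unfold initialPart at hne
  split_ifs at hne
  · exact absurd (eval₂_zero _ _) hne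
  · rw [← coe_eval₂Hom, map_sum] at hne
    obtain ⟨β, -, hβ⟩ := Finset.exists_ne_zero_of_sum_ne_zero hne
    rw [map_sum] at hβ
    obtain ⟨α, -, hα⟩ := Finset.exists_ne_zero_of_sum_ne_zero hβ
    rw [apply_ite (eval₂Hom _ _), map_zero, ite_ne_right_iff, coe_eval₂Hom,
      eval₂_evalOne_mixedMonomial] at hα
    exact ⟨β, α, right_ne_zero_of_mul hα.2, hα.1⟩

lemma IsOmegaSet.cancelsInitial_iff (hω : LinearIndependent ℚ ω) (hD : IsOmegaSet ω D) {r : ℚ}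
    (hr : 0 < r) {f : MixedRing N M K} : D.CancelsInitial ω r f ↔
      eval₂ (evalOne N K : LaurentRing N K →+* K) D.c (initialPart ω D.η f) = 0 := by
  have hr' : (r : ℝ) ≠ 0 := Rat.cast_ne_zero.2 hr.ne'
  constructor
  · intro hcancel
    by_contra hne
    obtain ⟨β, α, hβ, hw⟩ := exists_of_eval₂_initialPart_ne_zero hne
    rw [hD.mixedWeight_eq hω α hβ] at hw
    rw [← hD.coeff_eval₂_term hω hr.ne' hw.symm (omegaHom_smul ω r _)] at hne
    have hlt := hcancel _ hne
    rw [← hw, omegaHom_smul, mul_div_cancel_left₀ _ hr'] at hlt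
    exact hlt.false
  · intro hzero γ hγ
    obtain ⟨β, α, hα, hβ, rfl⟩ := OmegaData.exists_of_coeff_eval₂_term_ne_zero hγ
    have hle := mixedOrder_le (ω := ω) (η := D.η) hα
    rw [hD.mixedWeight_eq hω α hβ] at hle
    rw [omegaHom_smul, mul_div_cancel_left₀ _ hr']
    refine hle.lt_of_ne fun heq => hγ ?_
    rw [hD.coeff_eval₂_term hω hr.ne' heq (omegaHom_smul ω r _), hzero]

lemma IsOmegaSet.isStartingOmegaSet_iff (hω : LinearIndependent ℚ ω) (hD : IsOmegaSet ω D)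
    {I : Ideal (MixedRing N M K)} {r : ℚ} (hr : 0 < r) :
    IsStartingOmegaSet ω I D ↔ ∀ f ∈ I, D.CancelsInitial ω r f := by
  refine ⟨fun h f hf => (hD.cancelsInitial_iff hω hr).2
    (h.2.2 _ (Ideal.subset_span (Or.inl ⟨f, hf, rfl⟩))), fun h => ?_⟩
  have initialIdeal_le_ker : initialIdeal ω D.η I ≤
      RingHom.ker (eval₂Hom (evalOne N K : LaurentRing N K →+* K) D.c) := by
    refine Ideal.span_le.2 ?_
    rintro g (⟨f, hf, rfl⟩ | ⟨j, hj, rfl⟩)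
    · exact (hD.cancelsInitial_iff hω hr).1 (h f hf)
    · rw [SetLike.mem_coe, RingHom.mem_ker, eval₂Hom_X']
      exact by_contra fun hc => (hD.2.2 j).1 hc hj
  refine ⟨hD, fun α β a ha hβ hmem => ?_, fun f hf => initialIdeal_le_ker hf⟩
  have hzero := initialIdeal_le_ker hmem
  rw [RingHom.mem_ker, coe_eval₂Hom, eval₂_evalOne_mixedMonomial] at hzero
  exact mul_ne_zero ha (hD.prod_pow_ne_zero hβ) hzero

end Starting

/-! ### Sequences of `ω`-sets -/

section Sequence

variable {N M : ℕ} {K : Type*} [Field K] {ω : Fin N → ℝ} {I : Ideal (MixedRing N M K)} {L : ℕ∞}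
  {S : ℕ → OmegaData N M K} {i k : ℕ} {j : Fin M}

lemma ramIndex_pos {K : Type*} (S : ℕ → OmegaData N M K) (i : ℕ) : 0 < ramIndex S i :=
  one_div_pos.2 (Finset.prod_pos fun k _ => Nat.cast_pos.2 (S k).d_pos)

lemma ramIndex_zero {K : Type*} (S : ℕ → OmegaData N M K) : ramIndex S 0 = 1 := by
  simp [ramIndex]

lemma ramIndex_succ_mul_d {K : Type*} (S : ℕ → OmegaData N M K) (i : ℕ) :
    ramIndex S (i + 1) * (S i).d = ramIndex S i := by
  have h : ((S i).d : ℚ) ≠ 0 := Nat.cast_ne_zero.2 (S i).d_pos.ne'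
  rw [ramIndex, ramIndex, Finset.prod_range_succ, one_div, one_div, mul_inv, mul_assoc,
    inv_mul_cancel₀ h, mul_one]

/-- The exponent of the `i`-th term of the `j`-th series defined by a sequence. -/
def serExponent {K : Type*} (S : ℕ → OmegaData N M K) (i : ℕ) (j : Fin M) : Fin N → ℚ :=
  ramIndex S i • (S i).exponent j

/-- The sum of the first `i` terms of the `j`-th series defined by a sequence. -/
def partialSer (S : ℕ → OmegaData N M K) (i : ℕ) (j : Fin M) : FracRing N K :=
  truncation (serExponent S · j) (fun k => (S k).c j) i

lemma partialSer_zero (S : ℕ → OmegaData N M K) (j : Fin M) : partialSer S 0 j = 0 := by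
  simp [partialSer, truncation]

lemma partialSer_succ (S : ℕ → OmegaData N M K) (i : ℕ) (j : Fin M) :
    partialSer S (i + 1) j = partialSer S i j + (S i).term (ramIndex S i) j :=
  Finset.sum_range_succ _ _

/-- The successive substitutions of a polynomial along a sequence of `ω`-sets, which generate the
ideals `idealSeq`. -/
def polySeq (S : ℕ → OmegaData N M K) (f : MixedRing N M K) : ℕ → MixedRing N M K
  | 0 => f
  | i + 1 => (S i).subst (polySeq S f i)

lemma polySeq_mem_idealSeq (S : ℕ → OmegaData N M K) {f : MixedRing N M K} (hf : f ∈ I) (i : ℕ) :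
    polySeq S f i ∈ idealSeq I S i := by
  induction i with
  | zero => exact hf
  | succ i ih => exact Ideal.subset_span ⟨_, ih, rfl⟩

lemma eval₂_polySeq {R : Type*} [CommRing R] (S : ℕ → OmegaData N M K)
    (g : FracRing N K →+* R) (f : MixedRing N M K) (i : ℕ) (y : Fin M → R) :
    eval₂ (g.comp (fracEmb N K (ramIndex S i))) y (polySeq S f i) =
      eval₂ (g.comp (fracEmb N K 1)) (fun j => y j + g (partialSer S i j)) f := by
  induction i generalizing y with
  | zero => simp [polySeq, partialSer_zero, ramIndex_zero]
  | succ i ih =>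
    rw [polySeq, OmegaData.eval₂_subst, ramIndex_succ_mul_d, ih]
    congr 1
    funext j
    rw [partialSer_succ, map_add]
    ring

lemma eval₂_term_polySeq (S : ℕ → OmegaData N M K) (f : MixedRing N M K) (i : ℕ) :
    eval₂ (fracEmb N K (ramIndex S i)) ((S i).term (ramIndex S i)) (polySeq S f i) =
      eval₂ (fracEmb N K 1) (partialSer S (i + 1)) f := by
  have h := eval₂_polySeq S (RingHom.id _) f i ((S i).term (ramIndex S i))
  simp only [RingHom.id_comp, RingHom.id_apply] at h
  rw [h]
  congr 1
  funext j
  rw [partialSer_succ, add_comm]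

/-- The polynomial `f(x, y + p)`, where `p` is the tuple of the `i`-th partial sums: it is
`polySeq S f i`, written in the original variables `x`. -/
def shiftedPoly (S : ℕ → OmegaData N M K) (f : MixedRing N M K) (i : ℕ) :
    MvPolynomial (Fin M) (FracRing N K) :=
  eval₂ (C.comp (fracEmb N K 1)) (fun j => X j + C (partialSer S i j)) f

lemma map_polySeq (S : ℕ → OmegaData N M K) (f : MixedRing N M K) (i : ℕ) :
    MvPolynomial.map (fracEmb N K (ramIndex S i)) (polySeq S f i) = shiftedPoly S f i := by
  rw [shiftedPoly, ← eval₂_polySeq S C f i X, map_eq_eval₂Hom_C_comp, coe_eval₂Hom]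

lemma coeff_fracEmb_scaleHom {r : ℚ} (hr : r ≠ 0) (a : LaurentRing N K) (α : Fin N → ℤ) :
    (fracEmb N K r a).coeff (scaleHom N r α) = a.coeff α :=
  Finsupp.mapDomain_apply (scaleHom_injective hr) _ _

lemma d_mul_eta_lt_iff (hω : LinearIndependent ℚ ω) (hi : IsOmegaSet ω (S i))
    (hi' : IsOmegaSet ω (S (i + 1))) (hj : (S i).η j ≠ ⊤) (hj' : (S (i + 1)).η j ≠ ⊤) :
    (((S i).d : ℝ) : WithTop ℝ) * (S i).η j < (S (i + 1)).η j ↔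
      omegaHom ω (serExponent S i j) < omegaHom ω (serExponent S (i + 1) j) := by
  rw [hi.eta_eq hω hj, hi'.eta_eq hω hj', ← WithTop.coe_mul, WithTop.coe_lt_coe, serExponent,
    serExponent, omegaHom_smul, omegaHom_smul, ← ramIndex_succ_mul_d, Rat.cast_mul,
    Rat.cast_natCast, mul_assoc]
  exact (mul_lt_mul_iff_right₀ (Rat.cast_pos.2 (ramIndex_pos S (i + 1)))).symm

namespace IsOmegaSequence

lemma exists_weight_lt (hω : LinearIndependent ℚ ω) (hS : IsOmegaSequence ω I L S)
    (hi : (i : ℕ∞) ≤ L) {f : MixedRing N M K} (hf : f ∈ I) {γ : Fin N → ℚ}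
    (hγ : (eval₂ (fracEmb N K 1) (partialSer S (i + 1)) f).coeff γ ≠ 0) :
    ∃ β α, (coeff β (shiftedPoly S f i)).coeff α ≠ 0 ∧ (∀ j, (S i).η j = ⊤ → β j = 0) ∧
      omegaHom ω (α + ∑ j, β j • serExponent S i j) < omegaHom ω γ := by
  have hr := ramIndex_pos S i
  have hD := (hS.1 i hi).1
  rw [← eval₂_term_polySeq] at hγ
  obtain ⟨β, α, hα, hlt⟩ := mixedOrder_lt_iff.1 <|
    (hD.isStartingOmegaSet_iff hω hr).1 (hS.1 i hi) _ (polySeq_mem_idealSeq S hf i) γ hγ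
  have hβ := eq_zero_of_mixedWeight_ne_top hlt.ne_top
  rw [hD.mixedWeight_eq hω α (hD.prod_pow_ne_zero hβ), WithTop.coe_lt_coe,
    lt_div_iff₀' (Rat.cast_pos.2 hr), ← omegaHom_smul, OmegaData.smul_totalExponent] at hlt
  refine ⟨β, scaleHom N (ramIndex S i) α, ?_, hβ, hlt⟩
  rwa [← map_polySeq, coeff_map, coeff_fracEmb_scaleHom hr.ne']

lemma eta_ne_top_of_succ (hS : IsOmegaSequence ω I L S) (hi : ((i + 1 : ℕ) : ℕ∞) ≤ L)
    (hj : (S (i + 1)).η j ≠ ⊤) : (S i).η j ≠ ⊤ := by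
  intro h
  have hlt := hS.2 i hi j hj
  rw [h, WithTop.mul_top (by exact_mod_cast (S i).d_pos.ne')] at hlt
  exact not_top_lt hlt

lemma eta_ne_top_of_le (hS : IsOmegaSequence ω I L S) (hik : i ≤ k) (hk : (k : ℕ∞) ≤ L)
    (hj : (S k).η j ≠ ⊤) : (S i).η j ≠ ⊤ := by
  induction k, hik using Nat.le_induction with
  | base => exact hj
  | succ k _ ih =>
    exact ih (le_trans (by exact_mod_cast Nat.le_succ k) hk) (hS.eta_ne_top_of_succ hk hj)

lemma omegaHom_lt_succ (hω : LinearIndependent ℚ ω) (hS : IsOmegaSequence ω I L S)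
    (hi : ((i + 1 : ℕ) : ℕ∞) ≤ L) (hj : (S (i + 1)).η j ≠ ⊤) :
    omegaHom ω (serExponent S i j) < omegaHom ω (serExponent S (i + 1) j) :=
  (d_mul_eta_lt_iff hω (hS.1 i (le_trans (by exact_mod_cast Nat.le_succ i) hi)).1 (hS.1 _ hi).1
    (hS.eta_ne_top_of_succ hi hj) hj).1 (hS.2 i hi j hj)

lemma omegaHom_lt (hω : LinearIndependent ℚ ω) (hS : IsOmegaSequence ω I L S) (hik : i < k)
    (hk : (k : ℕ∞) ≤ L) (hj : (S k).η j ≠ ⊤) :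
    omegaHom ω (serExponent S i j) < omegaHom ω (serExponent S k j) := by
  induction k, hik using Nat.le_induction with
  | base => exact hS.omegaHom_lt_succ hω hk hj
  | succ k _ ih =>
    have hk' : (k : ℕ∞) ≤ L := le_trans (by exact_mod_cast Nat.le_succ k) hk
    exact (ih hk' (hS.eta_ne_top_of_succ hk hj)).trans (hS.omegaHom_lt_succ hω hk hj)

end IsOmegaSequence

lemma coeff_monomials_ne_zero_iff {γ : OmegaExp ω} :
    ((S i).monomials ω (ramIndex S i) j).1.coeff γ ≠ 0 ↔
      (S i).c j ≠ 0 ∧ γ = toExp ω (serExponent S i j) := by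
  change (HahnSeries.single (toExp ω (serExponent S i j)) ((S i).c j)).coeff γ ≠ 0 ↔ _
  classical
  rw [HahnSeries.coeff_single, ite_ne_right_iff, and_comm]

lemma IsOmegaSequence.contributors_subsingleton (hω : LinearIndependent ℚ ω)
    (hS : IsOmegaSequence ω I L S) (j : Fin M) (γ : OmegaExp ω) :
    (contributors ω L S j γ).Subsingleton := by
  have no_two : ∀ i ∈ contributors ω L S j γ, ∀ k ∈ contributors ω L S j γ, ¬ i < k := by
    rintro i ⟨-, hi⟩ k ⟨hkL, hk⟩ hik
    rw [coeff_monomials_ne_zero_iff] at hi hk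
    have hlt := hS.omegaHom_lt hω hik hkL (((hS.1 k hkL).1.2.2 j).1 hk.1)
    rw [show serExponent S i j = serExponent S k j from hi.2.symm.trans hk.2] at hlt
    exact hlt.false
  exact fun i hi k hk => le_antisymm (not_lt.1 (no_two k hk i hi)) (not_lt.1 (no_two i hi k hk))

end Sequence

/-! ### Cones and supports -/

section Cones

variable {E : Type*} {s : Set E}

lemma nonneg_of_mem_hull [AddCommGroup E] [Module ℝ E] {ℓ : E →ₗ[ℝ] ℝ} (hs : ∀ v ∈ s, 0 ≤ ℓ v)
    {v : E} (hv : v ∈ PointedCone.hull ℝ s) : 0 ≤ ℓ v := by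
  have hull_le : PointedCone.hull ℝ s ≤ (PointedCone.positive ℝ ℝ).comap ℓ :=
    Submodule.span_le.2 fun v hv => hs v hv
  exact hull_le hv

lemma exists_norm_le_mul_of_mem_hull [NormedAddCommGroup E] [NormedSpace ℝ E] {ℓ : E →ₗ[ℝ] ℝ}
    (hfin : s.Finite) (hs : ∀ v ∈ s, v ≠ 0 → 0 < ℓ v) :
    ∃ C, 0 ≤ C ∧ ∀ v ∈ PointedCone.hull ℝ s, ‖v‖ ≤ C * ℓ v := by
  obtain ⟨C, hC⟩ := (hfin.image fun v => ‖v‖ / ℓ v).bddAbove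
  refine ⟨max C 0, le_max_right _ _, fun v hv => ?_⟩
  induction hv using Submodule.span_induction with
  | mem v hv =>
    rcases eq_or_ne v 0 with rfl | hv0
    · simp
    · exact (div_le_iff₀ (hs v hv hv0)).1
        ((hC (Set.mem_image_of_mem _ hv)).trans (le_max_left _ _))
  | zero => simp
  | add u v _ _ hu hv =>
    rw [map_add, mul_add]
    exact (norm_add_le u v).trans (add_le_add hu hv)
  | smul a v _ hv =>
    have ha : (0 : ℝ) ≤ a := a.2
    change ‖(a : ℝ) • v‖ ≤ max C 0 * ℓ ((a : ℝ) • v)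
    rw [norm_smul, Real.norm_of_nonneg ha, map_smul, smul_eq_mul, mul_left_comm]
    exact mul_le_mul_of_nonneg_left hv ha

end Cones

section Supports

variable {N : ℕ} {ω : Fin N → ℝ}

lemma finite_setOf_norm_realVec_le {k : ℕ} (hk : 0 < k) (B : ℝ) :
    {a : Fin N → ℚ | (∀ l, ∃ z : ℤ, a l = z / k) ∧ ‖realVec a‖ ≤ B}.Finite := by
  have hk' : (0 : ℝ) < k := Nat.cast_pos.2 hk
  refine ((isCompact_iff_finite.1 (isCompact_closedBall (0 : Fin N → ℤ) (B * k))).image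
    fun z l => (z l : ℚ) / k).subset ?_
  rintro a ⟨hint, hB⟩
  choose z hz using hint
  refine ⟨z, ?_, funext fun l => (hz l).symm⟩
  have hB0 : 0 ≤ B := (norm_nonneg _).trans hB
  rw [mem_closedBall_zero_iff, pi_norm_le_iff_of_nonneg (by positivity)]
  intro l
  have hl := (norm_le_pi_norm (realVec a) l).trans hB
  rwa [realVec, hz l, Rat.cast_div, Rat.cast_intCast, Rat.cast_natCast, norm_div,
    Real.norm_of_nonneg hk'.le, div_le_iff₀ hk'] at hl

lemma IsOmegaPuiseuxSupport.finite_weight_le (hω : LinearIndependent ℚ ω)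
    {E : Set (Fin N → ℚ)} (hE : IsOmegaPuiseuxSupport ω E) (t : ℝ) :
    {a ∈ E | omegaHom ω a ≤ t}.Finite := by
  obtain ⟨⟨k, hk, hint⟩, γ, σ, ⟨s, rfl⟩, hpos, hσ⟩ := hE
  let ℓ := dotProductBilin ℝ ℝ ω
  obtain ⟨C, hC0, hC⟩ := exists_norm_le_mul_of_mem_hull (ℓ := ℓ)
    (s.finite_toSet.image realVec) <| by
      rintro _ ⟨v, hv, rfl⟩ hv0
      refine (hpos _ (PointedCone.subset_hull ⟨v, hv, rfl⟩)).lt_of_ne fun h => hv0 ?_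
      rw [omegaHom_injective hω (h.symm.trans (map_zero (omegaHom ω)).symm)]
      ext l
      simp [realVec]
  refine (finite_setOf_norm_realVec_le hk (C * (omegaHom ω γ + t) + ‖realVec γ‖)).subset ?_
  rintro a ⟨ha, hat⟩
  refine ⟨hint a ha, ?_⟩
  calc ‖realVec a‖ = ‖realVec (γ + a) - realVec γ‖ := by rw [realVec_add, add_sub_cancel_left]
    _ ≤ ‖realVec (γ + a)‖ + ‖realVec γ‖ := norm_sub_le _ _
    _ ≤ C * omegaHom ω (γ + a) + ‖realVec γ‖ := add_le_add_left (hC _ (hσ a ha)) _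
    _ ≤ C * (omegaHom ω γ + t) + ‖realVec γ‖ := by
      rw [map_add]
      gcongr

lemma IsOmegaPuiseuxSupport.exists_forall_lt_weight (hω : LinearIndependent ℚ ω)
    {E : Set (Fin N → ℚ)} (hE : IsOmegaPuiseuxSupport ω E) {P : ℕ → Prop} {e : ℕ → Fin N → ℚ}
    (hmem : ∀ i, P i → e i ∈ E)
    (hP : ∀ i, P (i + 1) → P i ∧ omegaHom ω (e i) < omegaHom ω (e (i + 1))) (B : ℝ) :
    ∃ n, ∀ i, n ≤ i → P i → B < omegaHom ω (e i) := by
  by_contra! hbdd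
  have below : ∀ i k, k ≤ i → P i → P k ∧ omegaHom ω (e k) ≤ omegaHom ω (e i) := by
    intro i k hik hi
    induction i, hik using Nat.le_induction with
    | base => exact ⟨hi, le_rfl⟩
    | succ i _ ih => exact ⟨(ih (hP i hi).1).1, (ih (hP i hi).1).2.trans (hP i hi).2.le⟩
  have all : ∀ k, P k ∧ omegaHom ω (e k) ≤ B := fun k => by
    obtain ⟨i, hki, hi, hB⟩ := hbdd k
    exact ⟨(below i k hki hi).1, (below i k hki hi).2.trans hB⟩
  have strictMono : StrictMono fun k => omegaHom ω (e k) :=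
    strictMono_nat_of_lt_succ fun k => (hP k (all (k + 1)).1).2
  exact Set.infinite_of_injective_forall_mem
    (fun k l h => strictMono.injective (congrArg (omegaHom ω) h))
    (fun k => (⟨hmem k (all k).1, (all k).2⟩ : e k ∈ {a ∈ E | omegaHom ω a ≤ B}))
    (hE.finite_weight_le hω B)

lemma isOmegaPuiseuxSupport_of_finite (ω : Fin N → ℝ) {E : Set (Fin N → ℚ)} (hE : E.Finite) :
    IsOmegaPuiseuxSupport ω E := by
  induction E, hE using Set.Finite.induction_on with
  | empty => exact (isOmegaPuiseuxSupport_singleton ω 0).mono (Set.empty_subset _)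
  | insert _ _ ih => exact (isOmegaPuiseuxSupport_singleton ω _).union ih

lemma isOmegaPuiseuxSupport_closure {T : Finset (Fin N → ℚ)} (hT : ∀ t ∈ T, 0 ≤ omegaHom ω t) :
    IsOmegaPuiseuxSupport ω (AddSubmonoid.closure (T : Set (Fin N → ℚ)) : Set (Fin N → ℚ)) := by
  obtain ⟨⟨k, hk, hint⟩, -⟩ := isOmegaPuiseuxSupport_of_finite ω T.finite_toSet
  refine ⟨⟨k, hk, fun t ht => ?_⟩, 0, PointedCone.hull ℝ (realVec '' (T : Set (Fin N → ℚ))),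
    ⟨T, rfl⟩, fun v hv => ?_, fun t ht => ?_⟩
  · induction ht using AddSubmonoid.closure_induction with
    | mem t ht => exact hint t ht
    | zero => exact fun l => ⟨0, by simp⟩
    | add a b _ _ ha hb =>
      intro l
      obtain ⟨z, hz⟩ := ha l
      obtain ⟨y, hy⟩ := hb l
      exact ⟨z + y, by rw [Pi.add_apply, hz, hy, Int.cast_add, add_div]⟩
  · exact nonneg_of_mem_hull (ℓ := dotProductBilin ℝ ℝ ω) (by
      rintro _ ⟨t, ht, rfl⟩
      exact hT t ht) hv
  · rw [zero_add]
    induction ht using AddSubmonoid.closure_induction with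
    | mem t ht => exact PointedCone.subset_hull ⟨t, ht, rfl⟩
    | zero => exact (show realVec (0 : Fin N → ℚ) = 0 by ext; simp [realVec]) ▸ zero_mem _
    | add a b _ _ ha hb => exact realVec_add a b ▸ add_mem ha hb

end Supports

/-! ### The series defined by an `ω`-sequence -/

section SeriesSupport

variable {N M : ℕ} {K : Type*} [Field K] {ω : Fin N → ℝ} {I : Ideal (MixedRing N M K)} {L : ℕ∞}
  {S : ℕ → OmegaData N M K} {j : Fin M}

lemma coeff_aeval_X {R : Type*} [CommRing R] (Q : Polynomial R) (j : Fin M) (β : Fin M →₀ ℕ) :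
    coeff β (Polynomial.aeval (X j : MvPolynomial (Fin M) R) Q) =
      if Finsupp.single j (β j) = β then Q.coeff (β j) else 0 := by
  classical
  induction Q using Polynomial.induction_on' with
  | add P Q hP hQ =>
    rw [map_add, coeff_add, hP, hQ, Polynomial.coeff_add]
    split_ifs <;> simp only [add_zero]
  | monomial k a =>
    rw [Polynomial.aeval_monomial, algebraMap_eq, coeff_C_mul, coeff_X_pow,
      Polynomial.coeff_monomial]
    by_cases hk : k = β j
    · simp [hk]
    · have hβ : Finsupp.single j k ≠ β := fun h => hk (by rw [← h, Finsupp.single_eq_same])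
      simp [hk, hβ]

lemma eval₂_aeval_X {R T : Type*} [CommRing R] [CommRing T] (g : R →+* T) (j : Fin M)
    (y : Fin M → T) (Q : Polynomial R) :
    eval₂ g y (Polynomial.aeval (X j : MvPolynomial (Fin M) R) Q) = Q.eval₂ g (y j) := by
  rw [← coe_eval₂Hom, Polynomial.aeval_def, Polynomial.hom_eval₂, algebraMap_eq,
    eval₂Hom_comp_C, eval₂Hom_X']

lemma shiftedPoly_aeval_X (S : ℕ → OmegaData N M K) (j : Fin M)
    (G : Polynomial (LaurentRing N K)) (i : ℕ) :
    shiftedPoly S (Polynomial.aeval (X j) G) i =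
      Polynomial.aeval (X j) (Polynomial.taylor (partialSer S i j) (G.map (fracEmb N K 1))) := by
  rw [shiftedPoly, eval₂_aeval_X, Polynomial.taylor_apply, Polynomial.aeval_def,
    Polynomial.eval₂_comp, Polynomial.eval₂_map, algebraMap_eq, Polynomial.eval₂_add,
    Polynomial.eval₂_X, Polynomial.eval₂_C]

lemma IsOmegaSequence.isNewtonSequence (hω : LinearIndependent ℚ ω)
    (hS : IsOmegaSequence ω I ⊤ S) (hj : ∀ i, (S i).η j ≠ ⊤) {G : Polynomial (LaurentRing N K)}
    (hG : Polynomial.aeval (X j : MixedRing N M K) G ∈ I) :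
    IsNewtonSequence (omegaHom ω) (G.map (fracEmb N K 1)) (serExponent S · j)
      (fun i => (S i).c j) where
  coeff_ne_zero i := ((hS.1 i le_top).1.2.2 j).2 (hj i)
  weight_lt i := hS.omegaHom_lt_succ hω le_top (hj _)
  cancels i γ hγ := by
    rw [← partialSer, Polynomial.eval_map, ← eval₂_aeval_X] at hγ
    obtain ⟨β, α, hα, -, hlt⟩ := hS.exists_weight_lt hω le_top hG hγ
    rw [shiftedPoly_aeval_X, coeff_aeval_X] at hα
    split_ifs at hα with hβ
    · refine ⟨β j, α, hα, ?_⟩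
      rw [← hβ] at hlt
      simpa [Finsupp.single_apply, ite_smul] using hlt
    · exact absurd rfl hα

lemma IsOmegaSequence.isOmegaPuiseuxSupport_range [CharZero K] (hω : LinearIndependent ℚ ω)
    (hS : IsOmegaSequence ω I ⊤ S) (hj : ∀ i, (S i).η j ≠ ⊤)
    {G : Polynomial (LaurentRing N K)} (hG : G ≠ 0)
    (hGI : Polynomial.aeval (X j : MixedRing N M K) G ∈ I) :
    IsOmegaPuiseuxSupport ω (Set.range fun i => serExponent S i j) := by
  have hF : G.map (fracEmb N K 1) ≠ 0 := (Polynomial.map_ne_zero_iff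
    (fracEmb_injective one_ne_zero)).2 hG
  obtain ⟨s, T, hT, htail⟩ :=
    (hS.isNewtonSequence hω hj hGI).exists_sub_mem_closure (omegaHom_injective hω) hF
  have isSupport_tail : IsOmegaPuiseuxSupport ω ((serExponent S · j) '' {i | s ≤ i}) := by
    refine (isOmegaPuiseuxSupport_singleton ω (serExponent S s j)).add
      (isOmegaPuiseuxSupport_closure hT) ?_
    rintro _ ⟨i, hi, rfl⟩
    exact ⟨_, rfl, _, htail i hi, add_sub_cancel _ _⟩
  have isSupport_head : IsOmegaPuiseuxSupport ω ((serExponent S · j) '' {i | i < s}) :=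
    isOmegaPuiseuxSupport_of_finite ω ((Set.finite_lt_nat s).image _)
  refine (isSupport_head.union isSupport_tail).mono ?_
  rintro _ ⟨i, rfl⟩
  exact (lt_or_ge i s).imp (fun hi => ⟨i, hi, rfl⟩) fun hi => ⟨i, hi, rfl⟩

lemma IsOmegaSequence.isOmegaPuiseuxSupport_contributors [CharZero K]
    (hω : LinearIndependent ℚ ω) (hS : IsOmegaSequence ω I L S)
    {G : Polynomial (LaurentRing N K)} (hG : G ≠ 0)
    (hGI : Polynomial.aeval (X j : MixedRing N M K) G ∈ I) :
    IsOmegaPuiseuxSupport ω {γ | (contributors ω L S j (toExp ω γ)).Nonempty} := by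
  by_cases hfin : ∃ n : ℕ, ∀ i : ℕ, (i : ℕ∞) ≤ L → (S i).c j ≠ 0 → i < n
  · obtain ⟨n, hn⟩ := hfin
    refine (isOmegaPuiseuxSupport_of_finite ω ((Set.finite_lt_nat n).image
      fun i => serExponent S i j)).mono ?_
    rintro γ ⟨i, hi, h⟩
    rw [coeff_monomials_ne_zero_iff] at h
    exact ⟨i, hn i hi h.1, h.2.symm⟩
  · push Not at hfin
    obtain rfl : L = ⊤ := by
      refine ENat.eq_top_iff_forall_ge.2 fun n => ?_
      obtain ⟨i, hi, -, hn⟩ := hfin n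
      exact (Nat.cast_le.2 hn).trans hi
    refine (hS.isOmegaPuiseuxSupport_range hω (j := j) (fun i => ?_) hG hGI).mono ?_
    · obtain ⟨k, hk, hc, hik⟩ := hfin i
      exact hS.eta_ne_top_of_le hik hk (((hS.1 k hk).1.2.2 j).1 hc)
    · rintro γ ⟨i, -, h⟩
      rw [coeff_monomials_ne_zero_iff] at h
      exact ⟨i, h.2.symm⟩

lemma contributors_nonempty_of_serCoeff_ne_zero {γ : OmegaExp ω} (h : serCoeff ω L S j γ ≠ 0) :
    (contributors ω L S j γ).Nonempty := by
  obtain ⟨i, hi⟩ := exists_ne_zero_of_finsum_mem_ne_zero h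
  exact ⟨i, hi.1⟩

theorem IsOmegaSequence.exists_isSeriesOf [CharZero K] (hω : LinearIndependent ℚ ω)
    (hI : ∀ j, ∃ G : Polynomial (LaurentRing N K), G ≠ 0 ∧
      Polynomial.aeval (X j : MixedRing N M K) G ∈ I)
    (hS : IsOmegaSequence ω I L S) : ∃ φ : Fin M → OmegaPuiseux K ω, IsSeriesOf ω L S φ := by
  have isSupport : ∀ j, IsOmegaPuiseuxSupport ω {γ | serCoeff ω L S j (toExp ω γ) ≠ 0} := by
    intro j
    obtain ⟨G, hG, hGI⟩ := hI j
    exact (hS.isOmegaPuiseuxSupport_contributors hω hG hGI).mono fun γ hγ =>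
      contributors_nonempty_of_serCoeff_ne_zero hγ
  exact ⟨fun j => ⟨⟨serCoeff ω L S j, (isSupport j).isPWO hω⟩, isSupport j⟩,
    fun j γ => ⟨(hS.contributors_subsingleton hω j γ).finite, rfl⟩⟩

end SeriesSupport

/-! ### Multiplicative filtrations -/

section Filtrations

variable {A R ι : Type*} [CommRing R]

lemma prod_sub_prod_mem [AddCommMonoid A] {W : A → AddSubgroup R} [SetLike.GradedMonoid W]
    (s : Finset ι) {u v : ι → R} {t : ι → A} {ε : A} (hu : ∀ i, u i ∈ W (t i))
    (hv : ∀ i, v i ∈ W (t i)) (huv : ∀ i, u i - v i ∈ W (t i + ε)) :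
    ∏ i ∈ s, u i - ∏ i ∈ s, v i ∈ W (∑ i ∈ s, t i + ε) := by
  classical
  induction s using Finset.induction_on with
  | empty => simp
  | insert a s ha ih =>
    rw [Finset.prod_insert ha, Finset.prod_insert ha, Finset.sum_insert ha]
    have telescope : u a * ∏ i ∈ s, u i - v a * ∏ i ∈ s, v i =
        (u a - v a) * ∏ i ∈ s, u i + v a * (∏ i ∈ s, u i - ∏ i ∈ s, v i) := by ring
    rw [telescope]
    refine add_mem ?_ ?_
    · rw [add_right_comm]
      exact SetLike.mul_mem_graded (huv a) (SetLike.prod_mem_graded _ _ _ fun i _ => hu i)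
    · rw [add_assoc]
      exact SetLike.mul_mem_graded (hv a) ih

lemma pow_sub_pow_mem [AddCommMonoid A] {W : A → AddSubgroup R} [SetLike.GradedMonoid W]
    {u v : R} {t ε : A} (hu : u ∈ W t) (hv : v ∈ W t) (huv : u - v ∈ W (t + ε)) (n : ℕ) :
    u ^ n - v ^ n ∈ W (n • t + ε) := by
  simpa using prod_sub_prod_mem (Finset.range n) (fun _ => hu) (fun _ => hv) fun _ => huv

variable [AddCommGroup A] [Fintype ι] {W : A → AddSubgroup R} {t : ι → A} {δ : A}

/-- The filtration of a polynomial ring which extends a filtration `W` of the coefficients and in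
which the variable `X j` has weight `t j`. -/
def polyFiltration (W : A → AddSubgroup R) (t : ι → A) (δ : A) :
    AddSubgroup (MvPolynomial ι R) where
  carrier := {F | ∀ β, coeff β F ∈ W (δ - ∑ j, β j • t j)}
  zero_mem' β := zero_mem _
  add_mem' {F G} hF hG β := coeff_add β F G ▸ add_mem (hF β) (hG β)
  neg_mem' {F} hF β := by simpa using hF β

lemma C_mem_polyFiltration {a : R} (ha : a ∈ W δ) : C a ∈ polyFiltration W t δ := by
  classical
  intro β
  rw [coeff_C]
  split_ifs with hβ
  · simpa [← hβ] using ha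
  · exact zero_mem _

variable [SetLike.GradedMonoid W] {Q : Type*} [CommRing Q] {g : Q →+* R} {f : MvPolynomial ι Q}
  {u v : ι → R} {ε : A}

lemma eval₂_mem_filtration (hu : ∀ j, u j ∈ W (t j))
    (hf : ∀ β, g (coeff β f) ∈ W (δ - ∑ j, β j • t j)) : eval₂ g u f ∈ W δ := by
  rw [eval₂_eq']
  refine sum_mem fun β _ => ?_
  rw [← sub_add_cancel δ (∑ j, β j • t j)]
  exact SetLike.mul_mem_graded (hf β) (SetLike.prod_pow_mem_graded _ _ _ _ fun j _ => hu j)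

lemma eval₂_sub_eval₂_mem_filtration (hu : ∀ j, u j ∈ W (t j)) (hv : ∀ j, v j ∈ W (t j))
    (huv : ∀ j, u j - v j ∈ W (t j + ε))
    (hf : ∀ β, (∀ j, u j = 0 → v j = 0 → β j = 0) → g (coeff β f) ∈ W (δ - ∑ j, β j • t j)) :
    eval₂ g u f - eval₂ g v f ∈ W (δ + ε) := by
  rw [eval₂_eq', eval₂_eq', ← Finset.sum_sub_distrib]
  refine sum_mem fun β _ => ?_
  rw [← mul_sub]
  by_cases hβ : ∀ j, u j = 0 → v j = 0 → β j = 0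
  · rw [← sub_add_cancel δ (∑ j, β j • t j), add_assoc]
    exact SetLike.mul_mem_graded (hf β hβ) <|
      prod_sub_prod_mem _ (fun j => SetLike.pow_mem_graded _ (hu j))
        (fun j => SetLike.pow_mem_graded _ (hv j))
        fun j => pow_sub_pow_mem (hu j) (hv j) (huv j) _
  · push Not at hβ
    obtain ⟨j, huj, hvj, hj⟩ := hβ
    rw [Finset.prod_eq_zero (Finset.mem_univ j) (by rw [huj, zero_pow hj]),
      Finset.prod_eq_zero (Finset.mem_univ j) (by rw [hvj, zero_pow hj]), sub_zero, mul_zero]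
    exact zero_mem _

instance : SetLike.GradedMonoid (polyFiltration W t) where
  one_mem β := by
    classical
    rw [coeff_one]
    split_ifs with hβ
    · simpa [← hβ] using SetLike.one_mem_graded W
    · exact zero_mem _
  mul_mem δ ε F G hF hG β := by
    classical
    rw [coeff_mul]
    refine sum_mem fun b hb => ?_
    have split_weight : δ + ε - ∑ j, β j • t j =
        (δ - ∑ j, b.1 j • t j) + (ε - ∑ j, b.2 j • t j) := by
      rw [← Finset.HasAntidiagonal.mem_antidiagonal.1 hb]
      simp only [Finsupp.add_apply, add_smul, Finset.sum_add_distrib]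
      abel
    rw [split_weight]
    exact SetLike.mul_mem_graded (hF b.1) (hG b.2)

lemma X_mem_polyFiltration (j : ι) : X j ∈ polyFiltration W t (t j) := by
  classical
  intro β
  rw [coeff_X]
  split_ifs with hβ
  · rw [← hβ, Finset.sum_eq_single j (fun k _ hk => by rw [Finsupp.single_eq_of_ne hk, zero_smul])
      (fun h => absurd (Finset.mem_univ j) h), Finsupp.single_eq_same, one_smul, sub_self]
    exact SetLike.one_mem_graded W
  · exact zero_mem _

end Filtrations

/-! ### Weights of series -/

section Weights

variable {N M : ℕ} {K : Type*} [Field K] {ω : Fin N → ℝ}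

/-- The series all of whose exponents have weight at least `t`. -/
def weightFiltration (K : Type*) [Field K] (ω : Fin N → ℝ) (t : ℝ) :
    AddSubgroup (HahnSeries (OmegaExp ω) K) where
  carrier := {a | ∀ γ, a.coeff γ ≠ 0 → t ≤ omegaHom ω γ}
  zero_mem' _ h := absurd rfl h
  add_mem' {a b} ha hb γ h := by
    by_cases h0 : a.coeff γ = 0
    · exact hb γ fun h1 => h (by rw [HahnSeries.coeff_add, h0, h1, add_zero])
    · exact ha γ h0
  neg_mem' ha γ h := ha γ (by simpa using h)

lemma omegaHom_add (α β : OmegaExp ω) :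
    omegaHom ω (α + β : OmegaExp ω) = omegaHom ω α + omegaHom ω β :=
  omegaDot_add ω α β

lemma single_mem_weightFiltration {α : Fin N → ℚ} {t : ℝ} (h : t ≤ omegaHom ω α) (c : K) :
    HahnSeries.single (toExp ω α) c ∈ weightFiltration K ω t := by
  intro γ hγ
  rwa [show γ = toExp ω α from by_contra fun h0 => hγ (HahnSeries.coeff_single_of_ne h0)]

instance : SetLike.GradedMonoid (weightFiltration K ω) where
  one_mem := single_mem_weightFiltration (map_zero (omegaHom ω)).ge 1
  mul_mem s t a b ha hb γ h := by
    obtain ⟨α, hα, β, hβ, rfl⟩ := HahnSeries.support_mul_subset h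
    exact (add_le_add (ha α hα) (hb β hβ)).trans (omegaHom_add α β).ge

lemma omegaHom_order_le {a : HahnSeries (OmegaExp ω) K} {γ : OmegaExp ω} (h : a.coeff γ ≠ 0) :
    omegaHom ω a.order ≤ omegaHom ω γ := by
  by_contra! hlt
  refine h (HahnSeries.coeff_eq_zero_of_lt_order (lt_of_le_of_ne (Or.inr hlt) ?_))
  rintro rfl
  exact hlt.false

lemma smul_single_one (α : OmegaExp ω) (c : K) :
    c • HahnSeries.single α (1 : K) = HahnSeries.single α c := by
  classical
  ext γ
  simp [HahnSeries.coeff_single]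

/-- The inclusion of the Laurent polynomials with rational exponents in the Hahn series. -/
def fracToHahn (K : Type*) [Field K] (ω : Fin N → ℝ) :
    FracRing N K →+* HahnSeries (OmegaExp ω) K :=
  (AddMonoidAlgebra.lift K (HahnSeries (OmegaExp ω) K) (Fin N → ℚ)
    { toFun := fun α => HahnSeries.single (toExp ω α.toAdd) 1
      map_one' := rfl
      map_mul' := fun α β => by
        rw [HahnSeries.single_mul_single, one_mul]
        rfl }).toRingHom

lemma fracToHahn_single (α : Fin N → ℚ) (c : K) :
    fracToHahn K ω (AddMonoidAlgebra.single α c) = HahnSeries.single (toExp ω α) c := by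
  change AddMonoidAlgebra.lift K _ (Fin N → ℚ) _ _ = _
  rw [AddMonoidAlgebra.lift_single]
  exact smul_single_one _ _

lemma coeff_fracToHahn (a : FracRing N K) (γ : Fin N → ℚ) :
    (fracToHahn K ω a).coeff (toExp ω γ) = a.coeff γ := by
  classical
  induction a using AddMonoidAlgebra.induction_linear with
  | zero => simp
  | add a b ha hb => simp [ha, hb]
  | single α c =>
    rw [fracToHahn_single, HahnSeries.coeff_single, AddMonoidAlgebra.coeff_single,
      Finsupp.single_apply]
    exact if_congr eq_comm rfl rfl

/-- The substitution `x ↦ x ^ {r I}`, from Laurent polynomials to Hahn series. -/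
def laurentToHahn (K : Type*) [Field K] (ω : Fin N → ℝ) (r : ℚ) :
    LaurentRing N K →+* HahnSeries (OmegaExp ω) K :=
  (fracToHahn K ω).comp (fracEmb N K r)

lemma laurentToHahn_mem_weightFiltration {r : ℚ} {a : LaurentRing N K} {t : ℝ}
    (h : ∀ α, a.coeff α ≠ 0 → t ≤ omegaHom ω (scaleHom N r α)) :
    laurentToHahn K ω r a ∈ weightFiltration K ω t := by
  classical
  intro γ hγ
  obtain ⟨α, hα, rfl⟩ := Finset.mem_image.1 (Finsupp.mapDomain_support
    (Finsupp.mem_support_iff.2 ((coeff_fracToHahn _ γ).symm.trans_ne hγ)))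
  exact h α (Finsupp.mem_support_iff.1 hα)

lemma laurentToPuiseux_val (a : LaurentRing N K) :
    (laurentToPuiseux K ω a).1 = laurentToHahn K ω 1 a := by
  induction a using AddMonoidAlgebra.induction_linear with
  | zero => simp
  | add a b ha hb => simp [ha, hb]
  | single α c =>
    rw [laurentToPuiseux, AddMonoidAlgebra.lift_single, laurentToHahn, RingHom.comp_apply,
      fracEmb_single, fracToHahn_single]
    change c • HahnSeries.single (toExp ω fun l => (α l : ℚ)) (1 : K) = _
    rw [smul_single_one]
    congr 2
    simp [scaleHom]

lemma isOmegaSolution_iff {I : Ideal (MixedRing N M K)} {φ : Fin M → OmegaPuiseux K ω} :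
    IsOmegaSolution ω I φ ↔ ∀ f ∈ I, eval₂ (laurentToHahn K ω 1) (fun j => (φ j).1) f = 0 := by
  refine forall₂_congr fun f _ => ?_
  have val_comp : ((OmegaPuiseux K ω).val : OmegaPuiseux K ω →+* HahnSeries (OmegaExp ω) K).comp
      (laurentToPuiseux K ω : LaurentRing N K →+* OmegaPuiseux K ω) = laurentToHahn K ω 1 :=
    RingHom.ext laurentToPuiseux_val
  have h := eval₂_comp_left
    ((OmegaPuiseux K ω).val : OmegaPuiseux K ω →+* HahnSeries (OmegaExp ω) K)
    (laurentToPuiseux K ω : LaurentRing N K →+* OmegaPuiseux K ω) φ f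
  rw [val_comp] at h
  change _ = eval₂ _ (fun j => (φ j).1) f at h
  rw [← h]
  exact (map_eq_zero_iff _ Subtype.val_injective).symm

end Weights

/-! ### The series of an infinite `ω`-sequence -/

section SeriesSolution

variable {N M : ℕ} {K : Type*} [Field K] {ω : Fin N → ℝ} {I : Ideal (MixedRing N M K)}
  {S : ℕ → OmegaData N M K} {φ : Fin M → OmegaPuiseux K ω} {i k : ℕ} {j : Fin M}

lemma fracToHahn_partialSer (S : ℕ → OmegaData N M K) (i : ℕ) (j : Fin M) :
    fracToHahn K ω (partialSer S i j) =
      ∑ k ∈ Finset.range i, ((S k).monomials ω (ramIndex S k) j).1 := by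
  rw [partialSer, truncation, map_sum]
  exact Finset.sum_congr rfl fun k _ => fracToHahn_single _ _

lemma coeff_fracToHahn_partialSer {γ : OmegaExp ω}
    (h : ∀ k, i ≤ k → k ∉ contributors ω ⊤ S j γ) :
    (fracToHahn K ω (partialSer S i j)).coeff γ = serCoeff ω ⊤ S j γ := by
  rw [fracToHahn_partialSer, HahnSeries.coeff_sum, serCoeff]
  symm
  refine finsum_mem_eq_sum_of_inter_support_eq _ (Set.ext fun k => ⟨fun hk => ⟨?_, hk.2⟩,
    fun hk => ⟨⟨le_top, hk.2⟩, hk.2⟩⟩)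
  by_contra hki
  exact h k (by simpa using hki) hk.1

lemma IsSeriesOf.sub_partialSer_mem (hφ : IsSeriesOf ω ⊤ S φ) {s : ℝ}
    (hs : ∀ k, i ≤ k → (S k).c j ≠ 0 → s ≤ omegaHom ω (serExponent S k j)) :
    (φ j).1 - fracToHahn K ω (partialSer S i j) ∈ weightFiltration K ω s := by
  intro γ hγ
  by_contra hlt
  rw [HahnSeries.coeff_sub, (hφ j γ).2] at hγ
  refine hγ (sub_eq_zero.2 (coeff_fracToHahn_partialSer fun k hik hk => hlt ?_).symm)
  obtain ⟨hc, rfl⟩ := coeff_monomials_ne_zero_iff.1 hk.2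
  exact hs k hik hc

lemma IsOmegaSequence.coeff_serExponent_ne_zero (hω : LinearIndependent ℚ ω)
    (hS : IsOmegaSequence ω I ⊤ S) (hφ : IsSeriesOf ω ⊤ S φ) (hc : (S i).c j ≠ 0) :
    (φ j).1.coeff (toExp ω (serExponent S i j)) ≠ 0 := by
  have hi : i ∈ contributors ω ⊤ S j (toExp ω (serExponent S i j)) :=
    ⟨le_top, coeff_monomials_ne_zero_iff.2 ⟨hc, rfl⟩⟩
  rw [(hφ j _).2, serCoeff, (hS.contributors_subsingleton hω j _).eq_singleton_of_mem hi,
    finsum_mem_singleton]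
  exact hi.2

lemma IsOmegaSequence.exists_forall_lt_weight (hω : LinearIndependent ℚ ω)
    (hS : IsOmegaSequence ω I ⊤ S) (hφ : IsSeriesOf ω ⊤ S φ) (B : Fin M → ℝ) :
    ∃ n, ∀ i, n ≤ i → ∀ j, (S i).η j ≠ ⊤ → B j < omegaHom ω (serExponent S i j) := by
  have tends_to_infinity := fun j => (φ j).2.exists_forall_lt_weight hω
    (P := fun i => (S i).η j ≠ ⊤) (e := fun i => serExponent S i j)
    (fun i hi => hS.coeff_serExponent_ne_zero hω hφ (((hS.1 i le_top).1.2.2 j).2 hi))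
    (fun i hi => ⟨hS.eta_ne_top_of_succ le_top hi, hS.omegaHom_lt_succ hω le_top hi⟩) (B j)
  choose n hn using tends_to_infinity
  exact ⟨Finset.univ.sup n, fun i hi j =>
    hn j i ((Finset.le_sup (Finset.mem_univ j)).trans hi)⟩

lemma IsOmegaSequence.omegaHom_le (hω : LinearIndependent ℚ ω) (hS : IsOmegaSequence ω I ⊤ S)
    (hik : i ≤ k) (hj : (S k).η j ≠ ⊤) :
    omegaHom ω (serExponent S i j) ≤ omegaHom ω (serExponent S k j) := by
  rcases hik.eq_or_lt with rfl | hlt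
  · exact le_rfl
  · exact (hS.omegaHom_lt hω hlt le_top hj).le

lemma exists_coeff_mem_weightFiltration (ω : Fin N → ℝ) (r : ℚ) (f : MixedRing N M K)
    (t : Fin M → ℝ) :
    ∃ δ : ℝ, ∀ β, laurentToHahn K ω r (coeff β f) ∈
      weightFiltration K ω (δ - ∑ j, β j • t j) := by
  classical
  obtain ⟨δ, hδ⟩ := (f.support.biUnion fun β => (coeff β f).coeff.support.image fun α =>
    omegaHom ω (scaleHom N r α) + ∑ j, β j • t j).bddBelow
  refine ⟨δ, fun β => laurentToHahn_mem_weightFiltration fun α hα => ?_⟩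
  rw [sub_le_iff_le_add]
  refine hδ (Finset.mem_biUnion.2 ⟨β, mem_support_iff.2 ?_, Finset.mem_image_of_mem _ ?_⟩)
  · rintro h
    exact hα (by rw [h]; rfl)
  · exact Finsupp.mem_support_iff.2 hα

lemma map_shiftedPoly_mem_polyFiltration {f : MixedRing N M K} {t : Fin M → ℝ} {δ : ℝ}
    (hf : ∀ β, laurentToHahn K ω 1 (coeff β f) ∈ weightFiltration K ω (δ - ∑ j, β j • t j))
    (hp : ∀ j, fracToHahn K ω (partialSer S i j) ∈ weightFiltration K ω (t j)) :
    MvPolynomial.map (fracToHahn K ω) (shiftedPoly S f i) ∈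
      polyFiltration (weightFiltration K ω) t δ := by
  have map_eq : MvPolynomial.map (fracToHahn K ω) (shiftedPoly S f i) =
      eval₂ (C.comp (laurentToHahn K ω 1))
        (fun j => X j + C (fracToHahn K ω (partialSer S i j))) f := by
    rw [shiftedPoly, eval₂_comp_left (MvPolynomial.map (fracToHahn K ω))]
    congr 1
    · exact RingHom.ext fun a => map_C _ _
    · funext j
      simp only [Function.comp_apply, map_add, map_X, map_C]
  rw [map_eq]
  exact eval₂_mem_filtration
    (fun j => add_mem (X_mem_polyFiltration j) (C_mem_polyFiltration (hp j)))
    fun β => C_mem_polyFiltration (hf β)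

lemma coeff_zero_shiftedPoly (S : ℕ → OmegaData N M K) (f : MixedRing N M K) (i : ℕ) :
    coeff 0 (shiftedPoly S f i) = eval₂ (fracEmb N K 1) (partialSer S i) f := by
  rw [← constantCoeff_eq, shiftedPoly, eval₂_comp_left constantCoeff]
  congr 1
  · exact RingHom.ext fun a => constantCoeff_C _ _
  · funext j
    simp only [Function.comp_apply, map_add, constantCoeff_X, constantCoeff_C, zero_add]

lemma sum_nsmul_add_le {ι : Type*} [Fintype ι] {t e : ι → ℝ} {B : ℝ} (hB : 0 ≤ B) {β : ι →₀ ℕ}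
    (hβ : β ≠ 0) (h : ∀ j, β j ≠ 0 → t j + B ≤ e j) :
    ∑ j, β j • t j + B ≤ ∑ j, β j • e j := by
  obtain ⟨k, hk⟩ := Finsupp.ne_iff.1 hβ
  have hk' : 1 ≤ ∑ j, β j := (Nat.one_le_iff_ne_zero.2 hk).trans
    (Finset.single_le_sum (fun _ _ => Nat.zero_le _) (Finset.mem_univ k))
  calc ∑ j, β j • t j + B
      ≤ ∑ j, β j • t j + (∑ j, β j) • B := by
        gcongr
        simpa using nsmul_le_nsmul_left hB hk'
    _ = ∑ j, β j • (t j + B) := by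
        simp only [nsmul_add, Finset.sum_add_distrib, Finset.sum_nsmul_assoc]
    _ ≤ ∑ j, β j • e j := by
        refine Finset.sum_le_sum fun j _ => ?_
        rcases eq_or_ne (β j) 0 with h0 | h0
        · simp [h0]
        · exact nsmul_le_nsmul_right (h j h0) _

lemma IsOmegaSequence.exists_weight_lt_or_lt_weight (hω : LinearIndependent ℚ ω)
    (hS : IsOmegaSequence ω I ⊤ S) {f : MixedRing N M K} (hf : f ∈ I) {t : Fin M → ℝ} {δ B : ℝ}
    (hδ : ∀ β, laurentToHahn K ω 1 (coeff β f) ∈ weightFiltration K ω (δ - ∑ j, β j • t j))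
    (hp : ∀ j, fracToHahn K ω (partialSer S i j) ∈ weightFiltration K ω (t j)) (hB : 0 ≤ B)
    (hi : ∀ j, (S i).η j ≠ ⊤ → t j + B ≤ omegaHom ω (serExponent S i j)) {γ : Fin N → ℚ}
    (hγ : (eval₂ (fracEmb N K 1) (partialSer S (i + 1)) f).coeff γ ≠ 0) :
    (∃ α, (eval₂ (fracEmb N K 1) (partialSer S i) f).coeff α ≠ 0 ∧
      omegaHom ω α < omegaHom ω γ) ∨ δ + B < omegaHom ω γ := by
  obtain ⟨β, α, hα, hβ, hlt⟩ := hS.exists_weight_lt hω le_top hf hγ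
  rcases eq_or_ne β 0 with rfl | hβ0
  · refine Or.inl ⟨α, coeff_zero_shiftedPoly S f i ▸ hα, ?_⟩
    simpa only [Finsupp.coe_zero, Pi.zero_apply, zero_smul, Finset.sum_const_zero, add_zero]
      using hlt
  · right
    have coeff_weight : δ - ∑ j, β j • t j ≤ omegaHom ω α := by
      refine map_shiftedPoly_mem_polyFiltration hδ hp β (toExp ω α) ?_
      rwa [coeff_map, coeff_fracToHahn]
    have term_weight := sum_nsmul_add_le hB hβ0 fun j hj => hi j (mt (hβ j) hj)
    rw [map_add, map_sum] at hlt
    simp only [map_nsmul] at hlt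
    linarith

lemma IsOmegaSequence.series_sub_partialSer_mem (hω : LinearIndependent ℚ ω)
    (hS : IsOmegaSequence ω I ⊤ S) (hφ : IsSeriesOf ω ⊤ S φ) (i : ℕ) (j : Fin M) :
    (φ j).1 - fracToHahn K ω (partialSer S i j) ∈
      weightFiltration K ω (omegaHom ω (serExponent S 0 j)) :=
  hφ.sub_partialSer_mem fun k _ hc =>
    hS.omegaHom_le hω k.zero_le (((hS.1 k le_top).1.2.2 j).1 hc)

lemma IsOmegaSequence.series_mem (hω : LinearIndependent ℚ ω) (hS : IsOmegaSequence ω I ⊤ S)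
    (hφ : IsSeriesOf ω ⊤ S φ) (j : Fin M) :
    (φ j).1 ∈ weightFiltration K ω (omegaHom ω (serExponent S 0 j)) := by
  simpa only [partialSer_zero, map_zero, sub_zero] using hS.series_sub_partialSer_mem hω hφ 0 j

lemma IsOmegaSequence.partialSer_mem (hω : LinearIndependent ℚ ω) (hS : IsOmegaSequence ω I ⊤ S)
    (hφ : IsSeriesOf ω ⊤ S φ) (i : ℕ) (j : Fin M) :
    fracToHahn K ω (partialSer S i j) ∈
      weightFiltration K ω (omegaHom ω (serExponent S 0 j)) := by
  simpa only [sub_sub_cancel] using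
    sub_mem (hS.series_mem hω hφ j) (hS.series_sub_partialSer_mem hω hφ i j)

lemma fracToHahn_eval₂ (r : ℚ) (p : Fin M → FracRing N K) (f : MixedRing N M K) :
    fracToHahn K ω (eval₂ (fracEmb N K r) p f) =
      eval₂ (laurentToHahn K ω r) (fun j => fracToHahn K ω (p j)) f :=
  eval₂_comp_left _ _ _ _

theorem IsOmegaSequence.isOmegaSolution (hω : LinearIndependent ℚ ω)
    (hS : IsOmegaSequence ω I ⊤ S) (hφ : IsSeriesOf ω ⊤ S φ) : IsOmegaSolution ω I φ := by
  refine isOmegaSolution_iff.2 fun f hf => ?_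
  by_contra hne
  set x := eval₂ (laurentToHahn K ω 1) (fun j => (φ j).1) f
  obtain ⟨δ, hδ⟩ := exists_coeff_mem_weightFiltration ω 1 f
    fun j => omegaHom ω (serExponent S 0 j)
  obtain ⟨B, hB, hxB⟩ : ∃ B : ℝ, 0 ≤ B ∧ omegaHom ω x.order < δ + B :=
    ⟨|omegaHom ω x.order - δ| + 1, by positivity,
      by linarith [le_abs_self (omegaHom ω x.order - δ)]⟩
  obtain ⟨n, hn⟩ := hS.exists_forall_lt_weight hω hφ
    fun j => omegaHom ω (serExponent S 0 j) + B
  have coeff_eq (i : ℕ) (hi : n ≤ i) (γ : Fin N → ℚ)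
      (hγ : omegaHom ω γ ≤ omegaHom ω x.order) :
      (eval₂ (fracEmb N K 1) (partialSer S i) f).coeff γ = x.coeff (toExp ω γ) := by
    have close := eval₂_sub_eval₂_mem_filtration (hS.series_mem hω hφ)
      (hS.partialSer_mem hω hφ i) (fun j => hφ.sub_partialSer_mem fun k hk hc =>
        (hn k (hi.trans hk) j (((hS.1 k le_top).1.2.2 j).1 hc)).le) fun β _ => hδ β
    by_contra hcoeff
    refine (hγ.trans_lt hxB).not_ge (close (toExp ω γ) ?_)
    rw [HahnSeries.coeff_sub, ← fracToHahn_eval₂, coeff_fracToHahn]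
    exact sub_ne_zero.2 (Ne.symm hcoeff)
  have leading_ne := (coeff_eq (n + 1) n.le_succ x.order le_rfl).trans_ne
    (HahnSeries.coeff_order_eq_zero.not.2 hne)
  rcases hS.exists_weight_lt_or_lt_weight hω hf hδ (hS.partialSer_mem hω hφ n) hB
    (fun j hj => (hn n le_rfl j hj).le) leading_ne with ⟨α, hα, hlt⟩ | hlt
  · rw [coeff_eq n le_rfl α hlt.le] at hα
    exact (omegaHom_order_le hα).not_gt hlt
  · exact hlt.not_gt hxB

end SeriesSolution

/-! ### The `ω`-sequence of a solution -/

section SolutionSequence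

variable {N M : ℕ} {K : Type*} [Field K] {ω : Fin N → ℝ} {I : Ideal (MixedRing N M K)}
  {a : HahnSeries (OmegaExp ω) K} {τ : Fin M → HahnSeries (OmegaExp ω) K} {i : ℕ} {j : Fin M}

/-- The exponent of least weight of a series, and `0` for the series `0`. -/
def leadExp (a : HahnSeries (OmegaExp ω) K) : Fin N → ℚ := a.order

/-- A series without its term of least weight. -/
def removeLead (a : HahnSeries (OmegaExp ω) K) : HahnSeries (OmegaExp ω) K :=
  a - HahnSeries.single a.order a.leadingCoeff

lemma leadExp_zero : leadExp (0 : HahnSeries (OmegaExp ω) K) = 0 :=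
  HahnSeries.order_zero (Γ := OmegaExp ω)

lemma removeLead_zero : removeLead (0 : HahnSeries (OmegaExp ω) K) = 0 := by
  simp [removeLead]

lemma mem_weightFiltration_leadExp (a : HahnSeries (OmegaExp ω) K) :
    a ∈ weightFiltration K ω (omegaHom ω (leadExp a)) :=
  fun _ => omegaHom_order_le

lemma coeff_removeLead_ne_zero_iff {γ : OmegaExp ω} :
    (removeLead a).coeff γ ≠ 0 ↔ a.coeff γ ≠ 0 ∧ γ ≠ a.order := by
  rcases eq_or_ne γ a.order with rfl | h
  · simp [removeLead, HahnSeries.leadingCoeff_eq]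
  · simp [removeLead, HahnSeries.coeff_single_of_ne h, h]

lemma weight_leadExp_lt (hω : LinearIndependent ℚ ω) {γ : OmegaExp ω}
    (h : (removeLead a).coeff γ ≠ 0) : omegaHom ω (leadExp a) < omegaHom ω γ := by
  obtain ⟨hγ, hne⟩ := coeff_removeLead_ne_zero_iff.1 h
  exact (omegaHom_order_le hγ).lt_of_ne fun heq => hne (omegaHom_injective hω heq).symm

lemma weight_leadExp_lt_leadExp_removeLead (hω : LinearIndependent ℚ ω) (h : removeLead a ≠ 0) :
    omegaHom ω (leadExp a) < omegaHom ω (leadExp (removeLead a)) :=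
  weight_leadExp_lt hω (HahnSeries.coeff_order_eq_zero.not.2 h)

lemma exists_removeLead_mem_weightFiltration (hω : LinearIndependent ℚ ω)
    (τ : Fin M → HahnSeries (OmegaExp ω) K) :
    ∃ ε : ℝ, 0 < ε ∧ ∀ j, removeLead (τ j) ∈
      weightFiltration K ω (omegaHom ω (leadExp (τ j)) + ε) := by
  have gap : ∀ j, ∃ ε : ℝ, 0 < ε ∧ ∀ e ≤ ε, removeLead (τ j) ∈
      weightFiltration K ω (omegaHom ω (leadExp (τ j)) + e) := fun j => by
    rcases eq_or_ne (removeLead (τ j)) 0 with h | h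
    · exact ⟨1, one_pos, fun e _ => h ▸ zero_mem _⟩
    · exact ⟨_, sub_pos.2 (weight_leadExp_lt_leadExp_removeLead hω h), fun e he γ hγ =>
        (le_sub_iff_add_le'.1 he).trans (mem_weightFiltration_leadExp _ γ hγ)⟩
  choose ε hε hgap using gap
  obtain ⟨e, he, hpos⟩ := ((Filter.eventually_all.2 fun j =>
    nhdsWithin_le_nhds (Iic_mem_nhds (hε j))).and (self_mem_nhdsWithin (s := Set.Ioi 0))).exists
  exact ⟨e, hpos, fun j => hgap j e (he j)⟩

open Classical in
/-- The `ω`-set of the leading terms of a tuple of series in `x ^ {r I}`. -/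
def leadData (r : ℚ) (τ : Fin M → HahnSeries (OmegaExp ω) K) : OmegaData N M K where
  η j := if τ j = 0 then ⊤ else ((omegaHom ω (r⁻¹ • leadExp (τ j)) : ℝ) : WithTop ℝ)
  Γ j l := if τ j = 0 then ⊤ else (((r⁻¹ • leadExp (τ j)) l : ℚ) : WithTop ℚ)
  c j := (τ j).leadingCoeff

lemma leadData_eta_eq_top {r : ℚ} : (leadData r τ).η j = ⊤ ↔ τ j = 0 := by
  simp only [leadData]
  split_ifs with h <;> simp [h]

lemma leadData_exponent (r : ℚ) (τ : Fin M → HahnSeries (OmegaExp ω) K) (j : Fin M) :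
    (leadData r τ).exponent j = r⁻¹ • leadExp (τ j) := by
  ext l
  rcases eq_or_ne (τ j) 0 with h | h
  · simp only [OmegaData.exponent, leadData, h, leadExp_zero, smul_zero]
    rfl
  · simp [OmegaData.exponent, leadData, h]

lemma isOmegaSet_leadData (hN : 0 < N) (hω : LinearIndependent ℚ ω) (r : ℚ)
    (τ : Fin M → HahnSeries (OmegaExp ω) K) : IsOmegaSet ω (leadData r τ) := by
  refine ⟨fun j => ?_, fun j hj l => if_pos (leadData_eta_eq_top.1 hj), fun j => ?_⟩
  · rcases eq_or_ne (τ j) 0 with h | h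
    · rw [leadData_eta_eq_top.2 h]
      refine WithTop.sum_eq_top.2 ⟨⟨0, hN⟩, Finset.mem_univ _, ?_⟩
      simp only [leadData, if_pos h, WithTop.map_top]
      exact WithTop.mul_top (by exact_mod_cast hω.ne_zero _)
    · simp only [leadData, if_neg h, WithTop.map_coe]
      change _ = ((∑ l, ω l * (((r⁻¹ • leadExp (τ j)) l : ℚ) : ℝ) : ℝ) : WithTop ℝ)
      simp only [WithTop.coe_sum, WithTop.coe_mul]
  · rw [Ne, Ne, leadData_eta_eq_top, not_iff_not]
    exact HahnSeries.leadingCoeff_eq_zero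

lemma fracToHahn_leadData_term {r : ℚ} (hr : r ≠ 0) (τ : Fin M → HahnSeries (OmegaExp ω) K)
    (j : Fin M) : fracToHahn K ω ((leadData r τ).term r j) = τ j - removeLead (τ j) := by
  rw [removeLead, sub_sub_cancel, OmegaData.term, fracToHahn_single, leadData_exponent,
    smul_inv_smul₀ hr]
  rfl

lemma leadData_cancelsInitial (hN : 0 < N) (hω : LinearIndependent ℚ ω) {r : ℚ} (hr : 0 < r)
    {f : MixedRing N M K} (hf : eval₂ (laurentToHahn K ω r) τ f = 0) :
    (leadData r τ).CancelsInitial ω r f := by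
  intro γ hγ
  by_contra! hle
  have hD := isOmegaSet_leadData hN hω r τ
  have term_eq := fracToHahn_leadData_term hr.ne' τ
  obtain ⟨ε, hε, hgap⟩ := exists_removeLead_mem_weightFiltration hω τ
  have term_mem (j) : fracToHahn K ω ((leadData r τ).term r j) ∈
      weightFiltration K ω (omegaHom ω (leadExp (τ j))) := by
    rw [OmegaData.term, fracToHahn_single, leadData_exponent, smul_inv_smul₀ hr.ne']
    exact single_mem_weightFiltration le_rfl _
  have close := eval₂_sub_eval₂_mem_filtration (g := laurentToHahn K ω r) (f := f)
    (δ := omegaHom ω γ) (fun j => mem_weightFiltration_leadExp (τ j)) term_mem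
    (fun j => by rw [term_eq, sub_sub_cancel]; exact hgap j) fun β hβ => by
      refine laurentToHahn_mem_weightFiltration fun α hα => ?_
      have monomial_weight := hle.trans (mixedOrder_le hα)
      rw [hD.mixedWeight_eq hω α (hD.prod_pow_ne_zero fun j hj => hβ j (leadData_eta_eq_top.1 hj)
        (by rw [term_eq, leadData_eta_eq_top.1 hj, removeLead_zero, sub_zero])),
        WithTop.coe_le_coe, div_le_iff₀' (Rat.cast_pos.2 hr), ← omegaHom_smul] at monomial_weight
      rw [OmegaData.smul_totalExponent] at monomial_weight
      simpa only [leadData_exponent, smul_inv_smul₀ hr.ne', map_add, map_sum, map_nsmul,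
        sub_le_iff_le_add] using monomial_weight
  rw [hf, zero_sub, ← fracToHahn_eval₂, neg_mem_iff] at close
  have := close (toExp ω γ) ((coeff_fracToHahn _ γ).trans_ne hγ)
  change omegaHom ω γ + ε ≤ omegaHom ω γ at this
  linarith

lemma isStartingOmegaSet_leadData (hN : 0 < N) (hω : LinearIndependent ℚ ω) {r : ℚ} (hr : 0 < r)
    (hτ : ∀ f ∈ I, eval₂ (laurentToHahn K ω r) τ f = 0) :
    IsStartingOmegaSet ω I (leadData r τ) :=
  ((isOmegaSet_leadData hN hω r τ).isStartingOmegaSet_iff hω hr).2 fun f hf =>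
    leadData_cancelsInitial hN hω hr (hτ f hf)

/-- The successive tails of a series. -/
def tailSeq (a : HahnSeries (OmegaExp ω) K) (i : ℕ) : HahnSeries (OmegaExp ω) K := removeLead^[i] a

lemma tailSeq_succ (a : HahnSeries (OmegaExp ω) K) (i : ℕ) :
    tailSeq a (i + 1) = removeLead (tailSeq a i) :=
  Function.iterate_succ_apply' _ _ _

lemma tailSeq_ne_zero (h : tailSeq a (i + 1) ≠ 0) : tailSeq a i ≠ 0 := by
  rintro h0
  exact h (by rw [tailSeq_succ, h0, removeLead_zero])

lemma weight_leadExp_tailSeq_lt (hω : LinearIndependent ℚ ω) (h : tailSeq a (i + 1) ≠ 0) :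
    omegaHom ω (leadExp (tailSeq a i)) < omegaHom ω (leadExp (tailSeq a (i + 1))) := by
  rw [tailSeq_succ] at h ⊢
  exact weight_leadExp_lt_leadExp_removeLead hω h

lemma coeff_ne_zero_of_coeff_tailSeq_ne_zero {γ : OmegaExp ω} (h : (tailSeq a i).coeff γ ≠ 0) :
    a.coeff γ ≠ 0 := by
  induction i with
  | zero => exact h
  | succ i ih =>
    rw [tailSeq_succ] at h
    exact ih (coeff_removeLead_ne_zero_iff.1 h).1

lemma exists_forall_lt_weight_tailSeq (hω : LinearIndependent ℚ ω) (a : OmegaPuiseux K ω)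
    (B : ℝ) :
    ∃ n, ∀ i, n ≤ i → tailSeq a.1 i ≠ 0 → B < omegaHom ω (leadExp (tailSeq a.1 i)) :=
  a.2.exists_forall_lt_weight hω
    (P := fun i => tailSeq a.1 i ≠ 0) (e := fun i => leadExp (tailSeq a.1 i))
    (fun _ hi => coeff_ne_zero_of_coeff_tailSeq_ne_zero (HahnSeries.coeff_order_eq_zero.not.2 hi))
    (fun _ hi => ⟨tailSeq_ne_zero hi, weight_leadExp_tailSeq_lt hω hi⟩) B

/-- The ramification indices of the `ω`-sequence of a solution. -/
def solutionRam (τ : Fin M → HahnSeries (OmegaExp ω) K) : ℕ → ℚ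
  | 0 => 1
  | i + 1 => solutionRam τ i / (leadData (solutionRam τ i) fun j => tailSeq (τ j) i).d

/-- The `ω`-sequence of a solution, which consists of the leading terms of its successive tails. -/
def solutionSeq (τ : Fin M → HahnSeries (OmegaExp ω) K) (i : ℕ) : OmegaData N M K :=
  leadData (solutionRam τ i) fun j => tailSeq (τ j) i

lemma ramIndex_solutionSeq (τ : Fin M → HahnSeries (OmegaExp ω) K) (i : ℕ) :
    ramIndex (solutionSeq τ) i = solutionRam τ i := by
  induction i with
  | zero => exact ramIndex_zero _
  | succ i ih =>
    rw [solutionRam, eq_div_iff (Nat.cast_ne_zero.2 (OmegaData.d_pos _).ne'), ← ih]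
    exact (congrArg _ (congrArg _ (congrArg OmegaData.d (by rw [solutionSeq, ih])))).trans
      (ramIndex_succ_mul_d _ i)

lemma solutionSeq_eq (τ : Fin M → HahnSeries (OmegaExp ω) K) (i : ℕ) :
    solutionSeq τ i = leadData (ramIndex (solutionSeq τ) i) fun j => tailSeq (τ j) i := by
  rw [ramIndex_solutionSeq, solutionSeq]

lemma serExponent_solutionSeq (τ : Fin M → HahnSeries (OmegaExp ω) K) (i : ℕ) (j : Fin M) :
    serExponent (solutionSeq τ) i j = leadExp (tailSeq (τ j) i) := by
  rw [serExponent, solutionSeq_eq, leadData_exponent]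
  exact smul_inv_smul₀ (ramIndex_pos _ i).ne' _

lemma fracToHahn_solutionSeq_term (τ : Fin M → HahnSeries (OmegaExp ω) K) (i : ℕ) (j : Fin M) :
    fracToHahn K ω ((solutionSeq τ i).term (ramIndex (solutionSeq τ) i) j) =
      tailSeq (τ j) i - tailSeq (τ j) (i + 1) := by
  rw [tailSeq_succ, ← fracToHahn_leadData_term (ramIndex_pos (solutionSeq τ) i).ne'
    (fun j => tailSeq (τ j) i), ← solutionSeq_eq]

lemma fracToHahn_partialSer_solutionSeq (τ : Fin M → HahnSeries (OmegaExp ω) K) (i : ℕ)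
    (j : Fin M) : fracToHahn K ω (partialSer (solutionSeq τ) i j) = τ j - tailSeq (τ j) i := by
  induction i with
  | zero => simp [partialSer_zero, tailSeq]
  | succ i ih =>
    rw [partialSer_succ, map_add, ih, fracToHahn_solutionSeq_term, sub_add_sub_cancel]

lemma eval₂_tailSeq_eq_zero (hτ : ∀ f ∈ I, eval₂ (laurentToHahn K ω 1) τ f = 0) (i : ℕ) :
    ∀ f ∈ idealSeq I (solutionSeq τ) i,
      eval₂ (laurentToHahn K ω (ramIndex (solutionSeq τ) i)) (fun j => tailSeq (τ j) i) f = 0 := by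
  induction i with
  | zero =>
    rw [ramIndex_zero]
    exact hτ
  | succ i ih =>
    have ideal_le_ker : idealSeq I (solutionSeq τ) (i + 1) ≤ RingHom.ker
        (eval₂Hom (laurentToHahn K ω (ramIndex (solutionSeq τ) (i + 1)))
          (fun j => tailSeq (τ j) (i + 1))) := by
      refine Ideal.span_le.2 ?_
      rintro _ ⟨f, hf, rfl⟩
      rw [SetLike.mem_coe, RingHom.mem_ker, coe_eval₂Hom, laurentToHahn, OmegaData.eval₂_subst,
        ramIndex_succ_mul_d, ← ih f hf]
      simp only [fracToHahn_solutionSeq_term, add_sub_cancel, laurentToHahn]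
    exact fun f hf => ideal_le_ker hf

lemma isOmegaSequence_solutionSeq (hN : 0 < N) (hω : LinearIndependent ℚ ω)
    (hτ : ∀ f ∈ I, eval₂ (laurentToHahn K ω 1) τ f = 0) :
    IsOmegaSequence ω I ⊤ (solutionSeq τ) := by
  have isOmegaSet (i) : IsOmegaSet ω (solutionSeq τ i) := isOmegaSet_leadData hN hω _ _
  refine ⟨fun i _ => ?_, fun i _ j hj => ?_⟩
  · rw [solutionSeq_eq]
    exact isStartingOmegaSet_leadData hN hω (ramIndex_pos _ i) (eval₂_tailSeq_eq_zero hτ i)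
  · have tail_ne : tailSeq (τ j) (i + 1) ≠ 0 := fun h => hj (leadData_eta_eq_top.2 h)
    rw [d_mul_eta_lt_iff hω (isOmegaSet i) (isOmegaSet (i + 1))
      (fun h => tailSeq_ne_zero tail_ne (leadData_eta_eq_top.1 h)) hj, serExponent_solutionSeq,
      serExponent_solutionSeq]
    exact weight_leadExp_tailSeq_lt hω tail_ne

theorem isSeriesOf_solutionSeq {φ : Fin M → OmegaPuiseux K ω} (hω : LinearIndependent ℚ ω)
    (hS : IsOmegaSequence ω I ⊤ (solutionSeq fun j => (φ j).1)) :
    IsSeriesOf ω ⊤ (solutionSeq fun j => (φ j).1) φ := by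
  intro j γ
  refine ⟨(hS.contributors_subsingleton hω j γ).finite, ?_⟩
  obtain ⟨n, hn⟩ := exists_forall_lt_weight_tailSeq hω (φ j) (omegaHom ω γ)
  have tail_coeff : (tailSeq (φ j).1 n).coeff γ = 0 := by
    by_contra h
    refine (hn n le_rfl ?_).not_ge (mem_weightFiltration_leadExp _ γ h)
    rintro h0
    exact h (by rw [h0, HahnSeries.coeff_zero])
  rw [← coeff_fracToHahn_partialSer (i := n), fracToHahn_partialSer_solutionSeq,
    HahnSeries.coeff_sub, tail_coeff, sub_zero]
  intro k hk hcontr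
  obtain ⟨hc, rfl⟩ := coeff_monomials_ne_zero_iff.1 hcontr.2
  have tail_ne : tailSeq (φ j).1 k ≠ 0 := HahnSeries.leadingCoeff_ne_zero.1 hc
  have hlt := hn k hk tail_ne
  rw [serExponent_solutionSeq] at hlt
  exact lt_irrefl _ hlt

theorem isOmegaSolution_iff_exists_isOmegaSequence (hN : 0 < N) (hω : LinearIndependent ℚ ω)
    (I : Ideal (MixedRing N M K)) (φ : Fin M → OmegaPuiseux K ω) :
    IsOmegaSolution ω I φ ↔
      ∃ S : ℕ → OmegaData N M K, IsOmegaSequence ω I ⊤ S ∧ IsSeriesOf ω ⊤ S φ := by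
  refine ⟨fun h => ?_, fun ⟨S, hS, hφ⟩ => hS.isOmegaSolution hω hφ⟩
  have hS := isOmegaSequence_solutionSeq hN hω (isOmegaSolution_iff.1 h)
  exact ⟨_, hS, isSeriesOf_solutionSeq hω hS⟩

end SolutionSequence

end

theorem mainTheorem3_general {K : Type*} [Field K] [CharZero K] {N M : ℕ} (hN : 0 < N)
    (ω : Fin N → ℝ) (hω : LinearIndependent ℚ ω) (I : Ideal (MixedRing N M K))
    (hI : ∀ j, ∃ G : Polynomial (LaurentRing N K),
      G ≠ 0 ∧ Polynomial.aeval (X j : MixedRing N M K) G ∈ I) :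
    (∀ (L : ℕ∞) (S : ℕ → OmegaData N M K), IsOmegaSequence ω I L S →
      ∃ φ : Fin M → OmegaPuiseux K ω, IsSeriesOf ω L S φ) ∧
    ∀ φ : Fin M → OmegaPuiseux K ω,
      IsOmegaSolution ω I φ ↔
        ∃ S : ℕ → OmegaData N M K, IsOmegaSequence ω I ⊤ S ∧ IsSeriesOf ω ⊤ S φ :=
  ⟨fun _ _ hS => hS.exists_isSeriesOf hω hI, isOmegaSolution_iff_exists_isOmegaSequence hN hω I⟩

theorem mainTheorem3 {K : Type*} [Field K] [IsAlgClosed K] [CharZero K] {N M : ℕ} (hN : 0 < N)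
    (ω : Fin N → ℝ) (hω : LinearIndependent ℚ ω)
    (I : Ideal (MixedRing N M K)) (hI : IsLaurentAdmissible I) :
    (∀ (L : ℕ∞) (S : ℕ → OmegaData N M K), IsOmegaSequence ω I L S →
      ∃ φ : Fin M → OmegaPuiseux K ω, IsSeriesOf ω L S φ) ∧
    ∀ φ : Fin M → OmegaPuiseux K ω,
      IsOmegaSolution ω I φ ↔
        ∃ S : ℕ → OmegaData N M K, IsOmegaSequence ω I ⊤ S ∧ IsSeriesOf ω ⊤ S φ :=
  mainTheorem3_general hN ω hω I hI.exists_aeval_mem
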